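/- Let $k$ be a field, let $\mathsf{C}$ be a $k$-linear abelian category, and let $\underline{\mathcal L}=(\mathcal L_i)_{i\in\mathbb Z}$ be a sequence of objects of $\mathsf C$ with endomorphism rings $D_i=\operatorname{End}\mathcal L_i$. Then $\operatorname{Hom}(\mathcal L_i,\mathcal L_{i+1})$ is a $k$-central $D_{i+1}$-$D_i$-bimodule. **Conventions.** For an $S$-$R$-bimodule $M$ write $M^*=\operatorname{Hom}_R(M_R,R)$ and ${}^*M=\operatorname{Hom}_S({}_SM,S)$ for its right and left duals; both are $R$-$S$-bimodules, via $(a\psi b)(x)=a\psi(bx)$ and $(a\varphi b)(x)=\varphi(xa)b$. Put $M^{0*}=M$, $M^{(i+1)*}=(M^{i*})^*$ for $i\ge 0$ and $M^{(i-1)*}={}^*(M^{i*})$ for $i\le 0$. A bimodule over division rings is *admissible* if $M^{i*}$ is finite-dimensional on both sides for all $i\in\mathbb Z$. A *$\mathbb Z$-algebra* is a $k$-linear category with objects indexed by $\mathbb Z$, written through components $A_{ij}$ with multiplication $A_{ij}\otimes A_{jl}\to A_{il}$; morphisms of $\mathbb Z$-algebras are $k$-linear and preserve the index set, and degree $n$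 refers to the components $A_{i,i+n}$. * If $M$ is admissible, $\mathbb S^{nc}(M)$ is the $\mathbb Z$-algebra generated by the bimodules $M^{i*}$ in the components $(i,i+1)$ over their coefficient division rings in the components $(i,i)$, with relations generated by the images of the canonical units (given by dual bases) in $M^{i*}\otimes M^{(i+1)*}$. * $\mathbb S^{nc}(\underline{\mathcal L})$ is the $\mathbb Z$-algebra generated over the rings $D_i$ in the components $(-i,-i)$ by the bimodules $\operatorname{Hom}(\mathcal L_i,\mathcal L_{i+1})$ in the components $(-(i+1),-i)$, with relations generated by the kernels of the compositions $\operatorname{Hom}(\mathcal L_{i+1},\mathcal L_{i+2})\otimes_{D_{i+1}}\operatorname{Hom}(\mathcal L_i,\mathcal L_{i+1})\to\operatorname{Hom}(\mathcal L_i,\mathcal L_{i+2})$. * $B_{\underline{\mathcal L}}$ is the $\mathbb Z$-algebra with $(B_{\underline{\mathcal L}})_{ij}=\operatorname{Hom}(\mathcal L_{-j},\mathcal L_{-i})$ and multiplication given by composition. **Helices.** $\underline{\mathcal L}$ is a *helix* if for all $i\in\mathbb Z$: 1. $D_i$ is a division ring; 2. $\operatorname{Hom}(\mathcal L_i,\mathcal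 L_{i+1})$ is finite-dimensional over $D_{i+1}$ on the left and over $D_i$ on the right; 3. there is a short exact sequence $0\to\mathcal L_i\xrightarrow{\eta}{}^*\operatorname{Hom}(\mathcal L_i,\mathcal L_{i+1})\otimes_{D_{i+1}}\mathcal L_{i+1}\to\mathcal L_{i+2}\to0$ in which $\eta$ is the canonical map; 4. the map $D_i\to D_{i+2}$ induced by this sequence and the left action of $D_i$ on ${}^*\operatorname{Hom}(\mathcal L_i,\mathcal L_{i+1})$ is an isomorphism; 5. the canonical map ${}^*\operatorname{Hom}(\mathcal L_i,\mathcal L_{i+1})\to\operatorname{Hom}(\mathcal L_{i+1},\mathcal L_{i+2})$, obtained by applying $\operatorname{Hom}(\mathcal L_{i+1},-)$ to the sequence in (3), is an isomorphism of $D_i$-$D_{i+1}$-bimodules, where $D_i$ acts on the target through (4). **Statement.** Suppose that $\underline{\mathcal L}$ is a helix. Then: 1. for all $i\in\mathbb Z$ the bimodule $\operatorname{Hom}(\mathcal L_i,\mathcal L_{i+1})$ is admissible, so that $\mathbb S^{nc}(\operatorname{Hom}(\mathcal L_i,\mathcal L_{i+1}))$ exists; 2. there is an isomorphism of $\mathbb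 Z$-algebras $\mathbb S^{nc}(\operatorname{Hom}(\mathcal L_{-1},\mathcal L_0))\to\mathbb S^{nc}(\underline{\mathcal L})$; 3. composing this isomorphism with the morphism $\mathbb S^{nc}(\underline{\mathcal L})\to B_{\underline{\mathcal L}}$ induced by composition in $\mathsf C$ gives a morphism of $\mathbb Z$-algebras $\mathbb S^{nc}(\operatorname{Hom}(\mathcal L_{-1},\mathcal L_0))\to B_{\underline{\mathcal L}}$ which is an isomorphism in degrees $0$ and $1$. -/

import Mathlib

open CategoryTheory MulOpposite
open scoped TensorProduct

universe w v u

namespace NCSym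

/-! ### ℤ-algebras -/

/-- A `ℤ`-algebra over `k`: a `k`-linear category with objects indexed by `ℤ`, written through its
components `A i j` with multiplication `A i j × A j l → A i l` and units `e i ∈ A i i`. -/
structure ZAlgebra (k : Type w) [Field k] where
  A : ℤ → ℤ → Type v
  [acg : ∀ i j, AddCommGroup (A i j)]
  [mod : ∀ i j, Module k (A i j)]
  mul : ∀ {i j l : ℤ}, A i j →ₗ[k] A j l →ₗ[k] A i l
  e : ∀ i, A i i
  e_mul : ∀ {i j} (x : A i j), mul (e i) x = x
  mul_e : ∀ {i j} (x : A i j), mul x (e j) = x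
  mul_assoc : ∀ {i j l m} (x : A i j) (y : A j l) (z : A l m),
    mul (mul x y) z = mul x (mul y z)

attribute [instance] ZAlgebra.acg ZAlgebra.mod

/-- A morphism of `ℤ`-algebras: a `k`-linear functor that is the identity on objects. -/
structure ZAlgebra.Hom {k : Type w} [Field k] (A : ZAlgebra.{w, v} k) (B : ZAlgebra.{w, v} k) where
  map : ∀ i j, A.A i j →ₗ[k] B.A i j
  map_e : ∀ i, map i i (A.e i) = B.e i
  map_mul : ∀ {i j l} (x : A.A i j) (y : A.A j l),
    map i l (A.mul x y) = B.mul (map i j x) (map j l y)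

/-- The composite `g ∘ f` of morphisms of `ℤ`-algebras. -/
def ZAlgebra.Hom.comp {k : Type w} [Field k] {A B E : ZAlgebra.{w, v} k}
    (g : B.Hom E) (f : A.Hom B) : A.Hom E where
  map i j := (g.map i j).comp (f.map i j)
  map_e i := by simp [f.map_e, g.map_e]
  map_mul x y := by simp [f.map_mul, g.map_mul]

/-- `f` is an isomorphism in degree `n`, that is, on the components `A i j` with
`j = i + n`. -/
def ZAlgebra.Hom.IsIsoInDegree {k : Type w} [Field k] {A B : ZAlgebra.{w, v} k}
    (f : A.Hom B) (n : ℤ) : Prop :=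
  ∀ i j, j = i + n → Function.Bijective (f.map i j)

/-- `f` is an isomorphism of `ℤ`-algebras. -/
def ZAlgebra.Hom.IsIso {k : Type w} [Field k] {A B : ZAlgebra.{w, v} k} (f : A.Hom B) : Prop :=
  ∀ i j, Function.Bijective (f.map i j)

/-! ### The tensor product over a noncommutative ring -/

/-- The subgroup of `V ⊗_ℤ W` generated by all `v d ⊗ w - v ⊗ d w`. -/
def balanced (D V W : Type v) [Ring D] [AddCommGroup V] [AddCommGroup W]
    [Module Dᵐᵒᵖ V] [Module D W] : AddSubgroup (V ⊗[ℤ] W) :=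
  AddSubgroup.closure
    {t | ∃ (x : V) (d : D) (y : W), t = (op d • x) ⊗ₜ[ℤ] y - x ⊗ₜ[ℤ] (d • y)}

/-- The tensor product `V ⊗_D W` of a right and a left module over a ring `D`. -/
abbrev BTensor (D V W : Type v) [Ring D] [AddCommGroup V] [AddCommGroup W]
    [Module Dᵐᵒᵖ V] [Module D W] : Type v :=
  (V ⊗[ℤ] W) ⧸ balanced D V W

/-- The pure tensor `x ⊗ y` in `V ⊗_D W`. -/
def BTensor.tmul (D : Type v) {V W : Type v} [Ring D] [AddCommGroup V] [AddCommGroup W]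
    [Module Dᵐᵒᵖ V] [Module D W] (x : V) (y : W) : BTensor D V W :=
  QuotientAddGroup.mk (x ⊗ₜ[ℤ] y)

/-- The additive map on `V ⊗_D W` induced by a biadditive `D`-balanced map. -/
def BTensor.lift {D V W P : Type v} [Ring D] [AddCommGroup V] [AddCommGroup W] [AddCommGroup P]
    [Module Dᵐᵒᵖ V] [Module D W] (f : V →+ W →+ P)
    (hf : ∀ (x : V) (d : D) (y : W), f (op d • x) y = f x (d • y)) : BTensor D V W →+ P :=
  QuotientAddGroup.lift (balanced D V W)
    (TensorProduct.liftAddHom f (fun r x y => by simp)) (by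
      unfold balanced
      rw [AddSubgroup.closure_le]
      rintro _ ⟨x, d, y, rfl⟩
      simp [hf])

/-! ### ℤ-algebras given by generators and quadratic relations -/

/-- `k`-algebras `D i`, a `k`-central `D i`-`D (i+1)`-bimodule `V i` for each `i`, and subsets
`rel i ⊆ V i ⊗ V (i+1)` (tensor product over `D (i+1)`). -/
structure QuadData (k : Type w) [Field k] where
  D : ℤ → Type v
  [ring : ∀ i, Ring (D i)]
  [alg : ∀ i, Algebra k (D i)]
  V : ℤ → Type v
  [acg : ∀ i, AddCommGroup (V i)]
  [modL : ∀ i, Module (D i) (V i)]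
  [modR : ∀ i, Module (D (i + 1))ᵐᵒᵖ (V i)]
  [bim : ∀ i, SMulCommClass (D i) (D (i + 1))ᵐᵒᵖ (V i)]
  central : ∀ i (c : k) (x : V i),
    algebraMap k (D i) c • x = op (algebraMap k (D (i + 1)) c) • x
  rel : ∀ i, Set (BTensor (D (i + 1)) (V i) (V (i + 1)))

attribute [instance] QuadData.ring QuadData.alg QuadData.acg QuadData.modL QuadData.modR
  QuadData.bim

namespace QuadData

variable {k : Type w} [Field k]

/-- Formal expressions in the generators `D i` (in component `(i, i)`) and `V i`
(in component `(i, i+1)`). -/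
inductive Term (Q : QuadData.{w, v} k) : ℤ → ℤ → Type v
  | zero (i j : ℤ) : Term Q i j
  | add {i j : ℤ} : Term Q i j → Term Q i j → Term Q i j
  | neg {i j : ℤ} : Term Q i j → Term Q i j
  | mul {i j l : ℤ} : Term Q i j → Term Q j l → Term Q i l
  | deg0 (i : ℤ) : Q.D i → Term Q i i
  | deg1 (i : ℤ) : Q.V i → Term Q i (i + 1)

/-- The expression `∑ x y`, over the pairs `(x, y)` in a list. -/
def Term.quad (Q : QuadData.{w, v} k) (i : ℤ) :
    List (Q.V i × Q.V (i + 1)) → Term Q i (i + 1 + 1)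
  | [] => Term.zero _ _
  | p :: l => Term.add (Term.mul (Term.deg1 i p.1) (Term.deg1 (i + 1) p.2)) (Term.quad Q i l)

/-- The smallest congruence for which the expressions form a `ℤ`-algebra, the maps from `D i` are
ring homomorphisms, the maps from `V i` are bimodule homomorphisms, and the elements of `rel i`
become zero. -/
inductive Rel (Q : QuadData.{w, v} k) : ∀ {i j : ℤ}, Term Q i j → Term Q i j → Prop
  | refl {i j} (x : Term Q i j) : Rel Q x x
  | symm {i j} {x y : Term Q i j} : Rel Q x y → Rel Q y x
  | trans {i j} {x y z : Term Q i j} : Rel Q x y → Rel Q y z → Rel Q x z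
  | add_congr {i j} {x x' y y' : Term Q i j} :
      Rel Q x x' → Rel Q y y' → Rel Q (.add x y) (.add x' y')
  | neg_congr {i j} {x x' : Term Q i j} : Rel Q x x' → Rel Q (.neg x) (.neg x')
  | mul_congr {i j l} {x x' : Term Q i j} {y y' : Term Q j l} :
      Rel Q x x' → Rel Q y y' → Rel Q (.mul x y) (.mul x' y')
  | add_assoc {i j} (x y z : Term Q i j) : Rel Q (.add (.add x y) z) (.add x (.add y z))
  | add_comm {i j} (x y : Term Q i j) : Rel Q (.add x y) (.add y x)
  | zero_add {i j} (x : Term Q i j) : Rel Q (.add (.zero i j) x) x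
  | neg_add {i j} (x : Term Q i j) : Rel Q (.add (.neg x) x) (.zero i j)
  | mul_assoc {i j l m} (x : Term Q i j) (y : Term Q j l) (z : Term Q l m) :
      Rel Q (.mul (.mul x y) z) (.mul x (.mul y z))
  | add_mul {i j l} (x y : Term Q i j) (z : Term Q j l) :
      Rel Q (.mul (.add x y) z) (.add (.mul x z) (.mul y z))
  | mul_add {i j l} (x : Term Q i j) (y z : Term Q j l) :
      Rel Q (.mul x (.add y z)) (.add (.mul x y) (.mul x z))
  | one_mul {i j} (x : Term Q i j) : Rel Q (.mul (.deg0 i 1) x) x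
  | mul_one {i j} (x : Term Q i j) : Rel Q (.mul x (.deg0 j 1)) x
  | deg0_add {i} (a b : Q.D i) : Rel Q (.deg0 i (a + b)) (.add (.deg0 i a) (.deg0 i b))
  | deg0_mul {i} (a b : Q.D i) : Rel Q (.deg0 i (a * b)) (.mul (.deg0 i a) (.deg0 i b))
  | deg1_add {i} (x y : Q.V i) : Rel Q (.deg1 i (x + y)) (.add (.deg1 i x) (.deg1 i y))
  | deg1_left {i} (a : Q.D i) (x : Q.V i) :
      Rel Q (.deg1 i (a • x)) (.mul (.deg0 i a) (.deg1 i x))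
  | deg1_right {i} (x : Q.V i) (b : Q.D (i + 1)) :
      Rel Q (.deg1 i (op b • x)) (.mul (.deg1 i x) (.deg0 (i + 1) b))
  | quad {i} (l : List (Q.V i × Q.V (i + 1))) :
      (l.map fun p => BTensor.tmul (Q.D (i + 1)) p.1 p.2).sum ∈ Q.rel i →
      Rel Q (Term.quad Q i l) (.zero i (i + 1 + 1))

def termSetoid (Q : QuadData.{w, v} k) (i j : ℤ) : Setoid (Term Q i j) :=
  ⟨Rel Q, Rel.refl, Rel.symm, Rel.trans⟩

/-- The `(i, j)` component of the `ℤ`-algebra presented by `Q`. -/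
def Comp (Q : QuadData.{w, v} k) (i j : ℤ) : Type v := Quotient (termSetoid Q i j)

variable (Q : QuadData.{w, v} k)

/-- The class of an expression. -/
def cls {i j : ℤ} (x : Term Q i j) : Comp Q i j := Quotient.mk (termSetoid Q i j) x

theorem cls_eq {i j : ℤ} {x y : Term Q i j} (h : Rel Q x y) : cls Q x = cls Q y :=
  Quotient.sound (s := termSetoid Q i j) h

def cadd {i j : ℤ} : Comp Q i j → Comp Q i j → Comp Q i j :=
  Quotient.map₂ Term.add fun _ _ h _ _ h' => Rel.add_congr h h'

def cneg {i j : ℤ} : Comp Q i j → Comp Q i j :=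
  Quotient.map Term.neg fun _ _ h => Rel.neg_congr h

def cmul {i j l : ℤ} : Comp Q i j → Comp Q j l → Comp Q i l :=
  Quotient.map₂ Term.mul fun _ _ h _ _ h' => Rel.mul_congr h h'

instance (i j : ℤ) : AddCommGroup (Comp Q i j) where
  add := cadd Q
  zero := cls Q (.zero i j)
  neg := cneg Q
  nsmul := @nsmulRec _ ⟨cls Q (.zero i j)⟩ ⟨cadd Q⟩
  zsmul := @zsmulRec _ ⟨cls Q (.zero i j)⟩ ⟨cadd Q⟩ ⟨cneg Q⟩
    (@nsmulRec _ ⟨cls Q (.zero i j)⟩ ⟨cadd Q⟩)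
  add_assoc := by rintro ⟨x⟩ ⟨y⟩ ⟨z⟩; exact cls_eq Q (.add_assoc x y z)
  add_comm := by rintro ⟨x⟩ ⟨y⟩; exact cls_eq Q (.add_comm x y)
  zero_add := by rintro ⟨x⟩; exact cls_eq Q (.zero_add x)
  add_zero := by rintro ⟨x⟩; exact cls_eq Q ((Rel.add_comm _ _).trans (.zero_add x))
  neg_add_cancel := by rintro ⟨x⟩; exact cls_eq Q (.neg_add x)

theorem cmul_assoc {i j l m : ℤ} (x : Comp Q i j) (y : Comp Q j l) (z : Comp Q l m) :
    cmul Q (cmul Q x y) z = cmul Q x (cmul Q y z) := by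
  induction x, y using Quotient.inductionOn₂ with | _ x y
  induction z using Quotient.inductionOn with | _ z
  exact cls_eq Q (.mul_assoc x y z)

theorem cadd_mul {i j l : ℤ} (x y : Comp Q i j) (z : Comp Q j l) :
    cmul Q (x + y) z = cmul Q x z + cmul Q y z := by
  induction x, y using Quotient.inductionOn₂ with | _ x y
  induction z using Quotient.inductionOn with | _ z
  exact cls_eq Q (.add_mul x y z)

theorem cmul_add {i j l : ℤ} (x : Comp Q i j) (y z : Comp Q j l) :
    cmul Q x (y + z) = cmul Q x y + cmul Q x z := by
  induction x, y using Quotient.inductionOn₂ with | _ x y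
  induction z using Quotient.inductionOn with | _ z
  exact cls_eq Q (.mul_add x y z)

theorem cmul_zero {i j l : ℤ} (x : Comp Q i j) : cmul Q x (0 : Comp Q j l) = 0 := by
  have h := cmul_add Q x (0 : Comp Q j l) 0
  rw [add_zero] at h
  exact left_eq_add.mp h

theorem czero_mul {i j l : ℤ} (x : Comp Q j l) : cmul Q (0 : Comp Q i j) x = 0 := by
  have h := cadd_mul Q (0 : Comp Q i j) 0 x
  rw [add_zero] at h
  exact left_eq_add.mp h

/-- The class of `d ∈ D i` in the component `(i, i)`. -/
def gen0 (i : ℤ) (d : Q.D i) : Comp Q i i := cls Q (.deg0 i d)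

/-- The class of `x ∈ V i` in the component `(i, i+1)`. -/
def gen1 (i : ℤ) (x : Q.V i) : Comp Q i (i + 1) := cls Q (.deg1 i x)

theorem cone_mul {i j : ℤ} (x : Comp Q i j) : cmul Q (gen0 Q i 1) x = x := by
  induction x using Quotient.inductionOn with | _ x
  exact cls_eq Q (.one_mul x)

theorem cmul_one {i j : ℤ} (x : Comp Q i j) : cmul Q x (gen0 Q j 1) = x := by
  induction x using Quotient.inductionOn with | _ x
  exact cls_eq Q (.mul_one x)

theorem gen0_add (i : ℤ) (a b : Q.D i) : gen0 Q i (a + b) = gen0 Q i a + gen0 Q i b :=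
  cls_eq Q (.deg0_add a b)

theorem gen0_mul (i : ℤ) (a b : Q.D i) : gen0 Q i (a * b) = cmul Q (gen0 Q i a) (gen0 Q i b) :=
  cls_eq Q (.deg0_mul a b)

theorem gen0_zero (i : ℤ) : gen0 Q i 0 = 0 := by
  have h := gen0_add Q i 0 0
  rw [add_zero] at h
  exact left_eq_add.mp h

/-- Scalars are central. -/
theorem scalar_comm {i j : ℤ} (c : k) (x : Comp Q i j) :
    cmul Q (gen0 Q i (algebraMap k _ c)) x = cmul Q x (gen0 Q j (algebraMap k _ c)) := by
  induction x using Quotient.inductionOn with | _ x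
  change cmul Q _ (cls Q x) = cmul Q (cls Q x) _
  induction x with
  | zero i j =>
    change cmul Q _ 0 = cmul Q 0 _
    rw [cmul_zero, czero_mul]
  | add x y hx hy =>
    change cmul Q _ (cls Q x + cls Q y) = cmul Q (cls Q x + cls Q y) _
    rw [cmul_add, cadd_mul, hx, hy]
  | neg x hx =>
    change cmul Q _ (-cls Q x) = cmul Q (-cls Q x) _
    rw [← add_left_inj (cmul Q (gen0 Q _ (algebraMap k _ c)) (cls Q x)), ← cmul_add]
    rw [hx, ← cadd_mul, neg_add_cancel, cmul_zero, czero_mul]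
  | mul x y hx hy =>
    change cmul Q _ (cmul Q (cls Q x) (cls Q y)) = cmul Q (cmul Q (cls Q x) (cls Q y)) _
    rw [← cmul_assoc, hx, cmul_assoc, hy, cmul_assoc]
  | deg0 i d =>
    change cmul Q _ (gen0 Q i d) = cmul Q (gen0 Q i d) _
    rw [← gen0_mul, ← gen0_mul, Algebra.commutes]
  | deg1 i x =>
    change cls Q _ = cls Q _
    refine cls_eq Q ((Rel.deg1_left _ x).symm.trans ?_)
    rw [Q.central]
    exact Rel.deg1_right x _

instance (i j : ℤ) : Module k (Comp Q i j) where
  smul c x := cmul Q (gen0 Q i (algebraMap k _ c)) x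
  one_smul x := by
    change cmul Q (gen0 Q i (algebraMap k _ 1)) x = x
    rw [map_one, cone_mul]
  mul_smul a b x := by
    change cmul Q (gen0 Q i (algebraMap k _ (a * b))) x = cmul Q _ (cmul Q _ x)
    rw [map_mul, gen0_mul, cmul_assoc]
  smul_zero a := cmul_zero Q _
  smul_add a x y := cmul_add Q _ x y
  add_smul a b x := by
    change cmul Q (gen0 Q i (algebraMap k _ (a + b))) x = cmul Q _ x + cmul Q _ x
    rw [map_add, gen0_add, cadd_mul]
  zero_smul x := by
    change cmul Q (gen0 Q i (algebraMap k _ 0)) x = 0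
    rw [map_zero, gen0_zero, czero_mul]

/-- The `ℤ`-algebra generated over the `D i` by the bimodules `V i`, placed in the components
`(i, i+1)`, with relations generated by the sets `rel i`. -/
def toZAlgebra : ZAlgebra.{w, v} k where
  A := Comp Q
  mul {i j l} := LinearMap.mk₂ k (cmul Q) (cadd_mul Q)
    (fun c x y => cmul_assoc Q _ x y) (cmul_add Q)
    (fun c x y => by
      change cmul Q x (cmul Q _ y) = cmul Q _ (cmul Q x y)
      rw [← cmul_assoc, ← cmul_assoc, scalar_comm])
  e i := gen0 Q i 1
  e_mul x := cone_mul Q x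
  mul_e x := cmul_one Q x
  mul_assoc x y z := cmul_assoc Q x y z

end QuadData

/-! ### Bimodules, their duals, and the noncommutative symmetric algebra of a bimodule -/

/-- A `k`-central `L`-`R`-bimodule; right modules over `R` are modules over `Rᵐᵒᵖ`. -/
structure Bimod (k : Type w) [Field k] where
  L : Type v
  R : Type v
  M : Type v
  [ringL : Ring L]
  [ringR : Ring R]
  [algL : Algebra k L]
  [algR : Algebra k R]
  [acg : AddCommGroup M]
  [modL : Module L M]
  [modR : Module Rᵐᵒᵖ M]
  [bim : SMulCommClass L Rᵐᵒᵖ M]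
  central : ∀ (c : k) (x : M), algebraMap k L c • x = op (algebraMap k R c) • x

attribute [instance] Bimod.ringL Bimod.ringR Bimod.algL Bimod.algR Bimod.acg Bimod.modL
  Bimod.modR Bimod.bim

namespace Bimod

variable {k : Type w} [Field k]

/-- The right `L`-module structure `(ψ b)(x) = ψ(b x)` on `Hom_R(M, R)`. -/
abbrev rdualModR (B : Bimod.{w, v} k) : Module B.Lᵐᵒᵖ (B.M →ₗ[B.Rᵐᵒᵖ] B.R) where
  smul b ψ :=
    { toFun := fun x => ψ (b.unop • x)
      map_add' := fun x y => by rw [smul_add, map_add]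
      map_smul' := fun a x => by rw [smul_comm, map_smul]; rfl }
  one_smul ψ := LinearMap.ext fun x => congrArg ψ (one_smul _ x)
  mul_smul a b ψ := LinearMap.ext fun x => congrArg ψ (mul_smul b.unop a.unop x)
  smul_zero _ := rfl
  smul_add _ _ _ := rfl
  add_smul a b ψ := LinearMap.ext fun x =>
    (congrArg ψ (add_smul a.unop b.unop x)).trans (map_add ψ _ _)
  zero_smul ψ := LinearMap.ext fun x => (congrArg ψ (zero_smul _ x)).trans (map_zero ψ)

/-- The right dual `M^* = Hom_R(M, R)`, an `R`-`L`-bimodule via `(a ψ b)(x) = a ψ(b x)`. -/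
abbrev rdual (B : Bimod.{w, v} k) : Bimod.{w, v} k :=
  letI := B.rdualModR
  { L := B.R
    R := B.L
    M := B.M →ₗ[B.Rᵐᵒᵖ] B.R
    bim := ⟨fun _ _ _ => rfl⟩
    central := fun c ψ => LinearMap.ext fun x => by
      change algebraMap k B.R c * ψ x = ψ (algebraMap k B.L c • x)
      rw [B.central, map_smul, op_smul_eq_mul, Algebra.commutes] }

/-- The left `R`-module structure `(a φ)(x) = φ(x a)` on `Hom_L(M, L)`. -/
abbrev ldualModL (B : Bimod.{w, v} k) : Module B.R (B.M →ₗ[B.L] B.L) where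
  smul a φ :=
    { toFun := fun x => φ (op a • x)
      map_add' := fun x y => by rw [smul_add, map_add]
      map_smul' := fun b x => by rw [← smul_comm, map_smul]; rfl }
  one_smul φ := LinearMap.ext fun x => congrArg φ (one_smul B.Rᵐᵒᵖ x)
  mul_smul a b φ := LinearMap.ext fun x => congrArg φ (mul_smul (op b) (op a) x)
  smul_zero _ := rfl
  smul_add _ _ _ := rfl
  add_smul a b φ := LinearMap.ext fun x =>
    (congrArg φ (add_smul (op a) (op b) x)).trans (map_add φ _ _)
  zero_smul φ := LinearMap.ext fun x => (congrArg φ (zero_smul B.Rᵐᵒᵖ x)).trans (map_zero φ)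

/-- The left dual `*M = Hom_L(M, L)`, an `R`-`L`-bimodule via `(a φ b)(x) = φ(x a) b`. -/
abbrev ldual (B : Bimod.{w, v} k) : Bimod.{w, v} k :=
  letI := B.ldualModL
  { L := B.R
    R := B.L
    M := B.M →ₗ[B.L] B.L
    bim := ⟨fun _ _ _ => rfl⟩
    central := fun c φ => LinearMap.ext fun x => by
      change φ (op (algebraMap k B.R c) • x) = φ x * algebraMap k B.L c
      rw [← B.central, map_smul, smul_eq_mul, Algebra.commutes] }

/-- `M^{n*}` for `n ≥ 0`. -/
def rdualIter (B : Bimod.{w, v} k) : ℕ → Bimod.{w, v} k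
  | 0 => B
  | n + 1 => (rdualIter B n).rdual

/-- `M^{-(n+1)*}` for `n ≥ 0`. -/
def ldualIter (B : Bimod.{w, v} k) : ℕ → Bimod.{w, v} k
  | 0 => B.ldual
  | n + 1 => (ldualIter B n).ldual

/-- The iterated duals: `M^{0*} = M`, `M^{(i+1)*} = (M^{i*})^*` for `i ≥ 0` and
`M^{(i-1)*} = *(M^{i*})` for `i ≤ 0`. -/
def dual (B : Bimod.{w, v} k) : ℤ → Bimod.{w, v} k
  | .ofNat n => rdualIter B n
  | .negSucc n => ldualIter B n

/-- A bimodule (over division rings) is admissible if all its iterated duals are finite-dimensional on both sides. -/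
def Admissible (B : Bimod.{w, v} k) : Prop :=
  ∀ i : ℤ, Module.Finite (B.dual i).L (B.dual i).M ∧ Module.Finite (B.dual i).Rᵐᵒᵖ (B.dual i).M

/-- The image of the unit `L → M ⊗_R M^*`, `d ↦ ∑ d b_s ⊗ b_s^*`, with `b` a basis of the right
module `M` and `b^*` the dual basis; the unit does not depend on the basis. -/
def unitR (B : Bimod.{w, v} k) : Set (BTensor B.R B.M B.rdual.M) :=
  {t | ∃ (n : ℕ) (b : Module.Basis (Fin n) B.Rᵐᵒᵖ B.M) (f : Fin n → B.rdual.M) (d : B.L),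
    (∀ s x, f s x = (b.repr x s).unop) ∧
    t = ∑ s, BTensor.tmul B.R (W := B.rdual.M) (d • b s) (f s)}

/-- The image of the unit `R → *M ⊗_L M`, `d ↦ ∑ d b_s^* ⊗ b_s`, with `b` a basis of the left
module `M` and `b^*` the dual basis; the unit does not depend on the basis. -/
def unitL (B : Bimod.{w, v} k) : Set (BTensor B.L B.ldual.M B.M) :=
  {t | ∃ (n : ℕ) (b : Module.Basis (Fin n) B.L B.M) (d : B.R),
    t = ∑ s, BTensor.tmul B.L (V := B.ldual.M) (B.ldual.modL.smul d (b.coord s)) (b s)}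

/-- `M^{i*}` is a right module over the left coefficient ring of `M^{(i+1)*}`. -/
@[reducible] def dualModR (B : Bimod.{w, v} k) :
    ∀ i : ℤ, Module (B.dual (i + 1)).Lᵐᵒᵖ (B.dual i).M
  | .ofNat n => (rdualIter B n).modR
  | .negSucc 0 => B.ldual.modR
  | .negSucc (n + 1) => (ldualIter B n).ldual.modR

attribute [local instance] dualModR

theorem dual_bim (B : Bimod.{w, v} k) :
    ∀ i : ℤ, SMulCommClass (B.dual i).L (B.dual (i + 1)).Lᵐᵒᵖ (B.dual i).M
  | .ofNat n => (rdualIter B n).bim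
  | .negSucc 0 => B.ldual.bim
  | .negSucc (n + 1) => (ldualIter B n).ldual.bim

theorem dual_central (B : Bimod.{w, v} k) :
    ∀ (i : ℤ) (c : k) (x : (B.dual i).M),
      algebraMap k (B.dual i).L c • x = op (algebraMap k (B.dual (i + 1)).L c) • x
  | .ofNat n => (rdualIter B n).central
  | .negSucc 0 => B.ldual.central
  | .negSucc (n + 1) => (ldualIter B n).ldual.central

/-- The image `Q_i` of the unit map into `M^{i*} ⊗ M^{(i+1)*}`. -/
def dualRel (B : Bimod.{w, v} k) :
    ∀ i : ℤ, Set (BTensor (B.dual (i + 1)).L (B.dual i).M (B.dual (i + 1)).M)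
  | .ofNat n => (rdualIter B n).unitR
  | .negSucc 0 => B.unitL
  | .negSucc (n + 1) => (ldualIter B n).unitL

/-- The generators `M^{i*}` and relations `Q_i` of the noncommutative symmetric algebra. -/
def ncSymData (B : Bimod.{w, v} k) : QuadData.{w, v} k where
  D i := (B.dual i).L
  V i := (B.dual i).M
  modR := B.dualModR
  bim := B.dual_bim
  central := B.dual_central
  rel := B.dualRel

/-- The noncommutative symmetric algebra of an admissible bimodule `M`: the `ℤ`-algebra generated
by the iterated duals `M^{i*}` in the components `(i, i+1)`, with relations generated by the
images of the units in `M^{i*} ⊗ M^{(i+1)*}`. -/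
def ncSym (B : Bimod.{w, v} k) (_h : B.Admissible) : ZAlgebra.{w, v} k :=
  B.ncSymData.toZAlgebra

end Bimod

/-! ### Sequences of objects: orbit algebra and noncommutative symmetric algebra -/

section Sequences

variable (k : Type w) [Field k] {C : Type u} [Category.{v} C] [Abelian C] [Linear k C]

theorem algebraMap_end_smul {X Y : C} (c : k) (f : X ⟶ Y) : algebraMap k (End Y) c • f = c • f := by
  change f ≫ (c • 𝟙 Y) = c • f
  simp

theorem algebraMap_end_op_smul {X Y : C} (c : k) (f : X ⟶ Y) :
    op (algebraMap k (End X) c) • f = c • f := by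
  change (c • 𝟙 X) ≫ f = c • f
  simp

/-- `Hom(X, Y)` as an `End Y`-`End X`-bimodule. -/
abbrev homBimod (X Y : C) : Bimod.{w, v} k where
  L := End Y
  R := End X
  M := X ⟶ Y
  bim := ⟨fun a b f => (Category.assoc b.unop f a)⟩
  central c f := by rw [algebraMap_end_smul, algebraMap_end_op_smul]

/-- The orbit algebra `B`, with `B i j = Hom(L_{-j}, L_{-i})`. -/
def orbitAlgebra (L : ℤ → C) : ZAlgebra.{w, v} k where
  A i j := L (-j) ⟶ L (-i)
  mul {i j l} := LinearMap.mk₂ k (fun (f : L (-j) ⟶ L (-i)) (g : L (-l) ⟶ L (-j)) => g ≫ f)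
    (by intros; simp) (by intros; simp) (by intros; simp) (by intros; simp)
  e i := 𝟙 _
  e_mul x := Category.comp_id x
  mul_e x := Category.id_comp x
  mul_assoc x y z := (Category.assoc z y x).symm

/-- Composition `Hom(Y, Z) ⊗_{End Y} Hom(X, Y) → Hom(X, Z)`. -/
def compMap (X Y Z : C) : BTensor (End Y) (Y ⟶ Z) (X ⟶ Y) →+ (X ⟶ Z) :=
  BTensor.lift
    { toFun := fun f => Preadditive.rightComp X f
      map_zero' := by ext; exact Limits.comp_zero
      map_add' := fun f g => by ext; exact Preadditive.comp_add _ _ _ _ _ _ }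
    (fun f d g => (Category.assoc g d f).symm)

/-- Generators and relations of the noncommutative symmetric algebra of a sequence. -/
def ncSymSeqData (L : ℤ → C) : QuadData.{w, v} k where
  D i := End (L (-i))
  V i := L (-(i + 1)) ⟶ L (-i)
  bim i := (homBimod k (L (-(i + 1))) (L (-i))).bim
  central i := (homBimod k (L (-(i + 1))) (L (-i))).central
  rel i := {t | compMap (L (-(i + 1 + 1))) (L (-(i + 1))) (L (-i)) t = 0}

/-- The noncommutative symmetric algebra of a sequence: generated in the component
`(-(i+1), -i)` by `Hom(L_i, L_{i+1})`, with relations generated by the kernels of composition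
`Hom(L_{i+1}, L_{i+2}) ⊗ Hom(L_i, L_{i+1}) → Hom(L_i, L_{i+2})`. -/
def ncSymSeq (L : ℤ → C) : ZAlgebra.{w, v} k := (ncSymSeqData k L).toZAlgebra

/-- The homomorphism from the noncommutative symmetric algebra of a sequence to its orbit algebra
is the one induced by composition if it is the identity on the generators. -/
def IsInducedByComposition (L : ℤ → C) (f : (ncSymSeq k L).Hom (orbitAlgebra k L)) : Prop :=
  (∀ (i : ℤ) (d : End (L (-i))), f.map i i ((ncSymSeqData k L).gen0 i d) = d) ∧
  (∀ (i : ℤ) (x : L (-(i + 1)) ⟶ L (-i)), f.map i (i + 1) ((ncSymSeqData k L).gen1 i x) = x)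

end Sequences

/-! ### Helices -/

section Helices

variable {C : Type u} [Category.{v} C] [Abelian C]

/-- Composition with `f : Z ⟶ X`, as a map of right `End Y`-modules. -/
def postcomp (Y : C) {Z X : C} (f : Z ⟶ X) : (Y ⟶ Z) →ₗ[(End Y)ᵐᵒᵖ] (Y ⟶ X) where
  toFun g := g ≫ f
  map_add' := by intros; simp
  map_smul' a g := Category.assoc a.unop g f

/-- An object `N ⊗_D Y` of `C`, where `D = End Y` and `N` is a right `D`-module: it represents
the functor `X ↦ Hom_D(N, Hom(Y, X))`. Here `ten n : Y ⟶ N ⊗_D Y` is `y ↦ n ⊗ y`. -/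
structure TensorObj (Y : C) (N : Type v) [AddCommGroup N] [Module (End Y)ᵐᵒᵖ N] where
  obj : C
  ten : N →ₗ[(End Y)ᵐᵒᵖ] (Y ⟶ obj)
  bij : ∀ X : C, Function.Bijective
    (fun f : obj ⟶ X => ((postcomp Y f).comp ten : N →ₗ[(End Y)ᵐᵒᵖ] (Y ⟶ X)))

namespace TensorObj

variable {Y : C} {N : Type v} [AddCommGroup N] [Module (End Y)ᵐᵒᵖ N] (T : TensorObj Y N)

/-- The morphism out of `N ⊗_D Y` that corresponds to `g : N → Hom(Y, X)`. -/
noncomputable def desc {X : C} (g : N →ₗ[(End Y)ᵐᵒᵖ] (Y ⟶ X)) : T.obj ⟶ X :=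
  (Equiv.ofBijective _ (T.bij X)).symm g

theorem ten_desc {X : C} (g : N →ₗ[(End Y)ᵐᵒᵖ] (Y ⟶ X)) (n : N) : T.ten n ≫ T.desc g = g n :=
  LinearMap.congr_fun ((Equiv.ofBijective _ (T.bij X)).apply_symm_apply g) n

/-- The endomorphism `f ⊗_D Y` of `N ⊗_D Y`. -/
noncomputable def map (f : N →ₗ[(End Y)ᵐᵒᵖ] N) : T.obj ⟶ T.obj := T.desc (T.ten.comp f)

theorem ten_map (f : N →ₗ[(End Y)ᵐᵒᵖ] N) (n : N) : T.ten n ≫ T.map f = T.ten (f n) :=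
  T.ten_desc _ n

end TensorObj

/-- The left dual `*Hom(X, Y)`, as a right `End Y`-module. -/
abbrev HomDual (X Y : C) : Type v := (X ⟶ Y) →ₗ[End Y] End Y

/-- The left action of `d ∈ End X` on `*Hom(X, Y)`: `(d φ)(h) = φ(h d)`. -/
def HomDual.act {X : C} (d : End X) (Y : C) : HomDual X Y →ₗ[(End Y)ᵐᵒᵖ] HomDual X Y where
  toFun φ :=
    { toFun := fun h => φ (op d • h)
      map_add' := fun h h' => by rw [smul_add, map_add]
      map_smul' := fun a h => by
        rw [show op d • a • h = a • op d • h from (Category.assoc d h a).symm, map_smul]; rfl }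
  map_add' _ _ := rfl
  map_smul' _ _ := rfl

/-- The canonical map `η : X ⟶ *Hom(X, Y) ⊗_{End Y} Y`, which is `x ↦ ∑ b_s^* ⊗ b_s(x)` for a basis
`b` of the left `End Y`-module `Hom(X, Y)`; it does not depend on the basis. -/
noncomputable def coev {X Y : C} {n : ℕ} (T : TensorObj Y (HomDual X Y))
    (b : Module.Basis (Fin n) (End Y) (X ⟶ Y)) : X ⟶ T.obj :=
  ∑ s, b s ≫ T.ten (b.coord s)

theorem coev_natural {X Y : C} {n : ℕ} (T : TensorObj Y (HomDual X Y))
    (b : Module.Basis (Fin n) (End Y) (X ⟶ Y)) (d : End X) :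
    coev T b ≫ T.map (HomDual.act d Y) = d ≫ coev T b := by
  have h : ∀ t, HomDual.act d Y (b.coord t) =
      ∑ s, op (b.coord t (op d • b s) : End Y) • (b.coord s : HomDual X Y) := fun t =>
    b.ext fun r => by
      have : ∀ s, (op (b.coord t (op d • b s) : End Y) • (b.coord s : HomDual X Y)) (b r) =
          b.coord s (b r) * b.coord t (op d • b s) := fun _ => rfl
      rw [LinearMap.sum_apply, Finset.sum_congr rfl fun s _ => this s]
      simp only [Module.Basis.coord_apply, Module.Basis.repr_self, Finsupp.single_apply]
      rw [Finset.sum_eq_single r (fun s _ hs => by rw [if_neg hs.symm, zero_mul]) (by simp)]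
      rw [if_pos rfl, one_mul]
      rfl
  have h' : ∀ s, d ≫ b s = ∑ t, b t ≫ (b.coord t (op d • b s) : End Y) := fun s =>
    (b.sum_repr (op d • b s)).symm
  unfold coev
  rw [Preadditive.sum_comp, Preadditive.comp_sum]
  simp only [Category.assoc, TensorObj.ten_map, h, map_sum, map_smul]
  simp only [← Category.assoc, h', Preadditive.sum_comp, Preadditive.comp_sum]
  rw [Finset.sum_comm]
  refine Finset.sum_congr rfl fun s _ => Finset.sum_congr rfl fun t _ => ?_
  rw [Category.assoc]
  rfl

/-- An Euler sequence `0 ⟶ X ⟶ *Hom(X, Y) ⊗_{End Y} Y ⟶ Z ⟶ 0`, whose first map is the canonical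
map `η`. -/
structure EulerSeq (X Y Z : C) where
  n : ℕ
  basis : Module.Basis (Fin n) (End Y) (X ⟶ Y)
  T : TensorObj Y (HomDual X Y)
  p : T.obj ⟶ Z
  zero : coev T basis ≫ p = 0
  shortExact : (ShortComplex.mk (coev T basis) p zero).ShortExact

namespace EulerSeq

variable {X Y Z : C} (E : EulerSeq X Y Z)

/-- The canonical map `Φ : End X → End Z`: the endomorphism `Φ d` of `Z` is induced by the
endomorphism `d ⊗ Y` of `*Hom(X, Y) ⊗ Y`. -/
noncomputable def Phi (d : End X) : End Z :=
  haveI := E.shortExact.epi_g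
  E.shortExact.exact.desc (E.T.map (HomDual.act d Y) ≫ E.p) (by
    change coev E.T E.basis ≫ E.T.map (HomDual.act d Y) ≫ E.p = 0
    rw [← Category.assoc, coev_natural, Category.assoc, E.zero, Limits.comp_zero])

theorem p_Phi (d : End X) : E.p ≫ E.Phi d = E.T.map (HomDual.act d Y) ≫ E.p :=
  haveI := E.shortExact.epi_g
  E.shortExact.exact.g_desc _ _

/-- The canonical map `*Hom(X, Y) → Hom(Y, Z)` obtained by applying `Hom(Y, -)` to the second map
of the Euler sequence: `φ` goes to `Y ⟶ *Hom(X, Y) ⊗ Y ⟶ Z`, `y ↦ p(φ ⊗ y)`. It is a map of right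
`End Y`-modules. -/
noncomputable def canon : HomDual X Y →ₗ[(End Y)ᵐᵒᵖ] (Y ⟶ Z) := (postcomp Y E.p).comp E.T.ten

/-- The canonical map is also a map of left `End X`-modules, where `End X` acts on `Hom(Y, Z)`
through `Φ`. -/
theorem canon_act (d : End X) (φ : HomDual X Y) :
    E.canon (HomDual.act d Y φ) = E.Phi d • E.canon φ := by
  change E.T.ten _ ≫ E.p = (E.T.ten φ ≫ E.p) ≫ E.Phi d
  rw [Category.assoc, p_Phi, ← Category.assoc, TensorObj.ten_map]

end EulerSeq

/-- A sequence of objects of a `k`-linear abelian category is a helix. (The field `k` lies in the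
center of every endomorphism ring, since the category is `k`-linear. Two Euler sequences with the
same terms differ by an automorphism of the third term, so the last two conditions do not depend on
the choice of the Euler sequence.) -/
structure IsHelix (L : ℤ → C) : Prop where
  nontrivial : ∀ i, Nontrivial (End (L i))
  isUnit : ∀ i, ∀ d : End (L i), d ≠ 0 → IsUnit d
  finite_left : ∀ i, Module.Finite (End (L (i + 1))) (L i ⟶ L (i + 1))
  finite_right : ∀ i, Module.Finite (End (L i))ᵐᵒᵖ (L i ⟶ L (i + 1))
  euler : ∀ i, ∃ E : EulerSeq (L i) (L (i + 1)) (L (i + 2)),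
    Function.Bijective E.Phi ∧ Function.Bijective E.canon

end Helices

end NCSym

/-! Write V_i = Hom(L_{-(i+1)}, L_{-i}). The canonical maps of the Euler sequences give isomorphisms
*V_{i+1} ≅ V_i, semilinear over Φ on the left (`EulerSeq.canonIso`). A finitely generated free
module is the right dual of its left dual, so dualising gives V_{i+1} ≅ (V_i)^*
(`EulerSeq.adjointIso`). Starting from V_0 = Hom(L_{-1}, L_0) and moving in both directions, the
i-th iterated dual of V_0 is V_i, which is finite on both sides. This is admissibility for one
index, and shifting the helix gives the others.

It remains to match the quadratic relations. For consecutive X, Y, Z a tensor ∑ φ_j ⊗ x_j in *Hom(X,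
Y) ⊗ Hom(X, Y) defines a morphism f : X ⟶ *Hom(X, Y) ⊗ Y. Its image under composition is f ≫ p, so
it vanishes exactly when f = d ≫ η for some d in End X, by exactness. Since evaluations at h : X ⟶ Y
separate morphisms into *Hom(X, Y) ⊗ Y, this says ∑ φ_j(h) x_j = d ≫ h for all h
(`EulerSeq.comp_eq_zero_iff`). The multiples of the canonical unit satisfy the same criterion: they
are the tensors that contract to multiplication by a scalar (`Bimod.mem_unitL_iff`,
`Bimod.mem_unitR_iff`). Hence kernels of composition and images of units correspond, and the two
presentations are isomorphic.

In degrees 0 and 1 a presented algebra contains only classes of generators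
(`QuadData.comp_low_degree`). Composition sends the class of a generator back to that generator, so
nothing collapses and every morphism is reached. -/

namespace NCSym

/-! ### The universal property of a presented `ℤ`-algebra -/

namespace QuadData

variable {k : Type w} [Field k]

/-- Images of the generators of `Q` in a `ℤ`-algebra that satisfy the defining relations. -/
structure Rep (Q : QuadData.{w, v} k) (A : ZAlgebra.{w, v} k) where
  f0 : ∀ i, Q.D i →+ A.A i i
  f1 : ∀ i, Q.V i →+ A.A i (i + 1)
  f0_algebraMap : ∀ i (c : k), f0 i (algebraMap k _ c) = c • A.e i
  f0_mul : ∀ i (a b : Q.D i), f0 i (a * b) = A.mul (f0 i a) (f0 i b)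
  f1_left : ∀ i (a : Q.D i) (x : Q.V i), f1 i (a • x) = A.mul (f0 i a) (f1 i x)
  f1_right : ∀ i (x : Q.V i) (b : Q.D (i + 1)),
    f1 i (op b • x) = A.mul (f1 i x) (f0 (i + 1) b)
  f1_rel : ∀ i (l : List (Q.V i × Q.V (i + 1))),
    (l.map fun p => BTensor.tmul (Q.D (i + 1)) p.1 p.2).sum ∈ Q.rel i →
    (l.map fun p => A.mul (f1 i p.1) (f1 (i + 1) p.2)).sum = 0

namespace Rep

variable {Q : QuadData.{w, v} k} {A : ZAlgebra.{w, v} k} (F : Rep Q A)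

theorem f0_one (i : ℤ) : F.f0 i 1 = A.e i := by
  rw [← map_one (algebraMap k (Q.D i)), F.f0_algebraMap, one_smul]

/-- The value of a formal expression. -/
def eval : ∀ {i j : ℤ}, Term Q i j → A.A i j
  | _, _, .zero _ _ => 0
  | _, _, .add x y => eval x + eval y
  | _, _, .neg x => -eval x
  | _, _, .mul x y => A.mul (eval x) (eval y)
  | _, _, .deg0 i d => F.f0 i d
  | _, _, .deg1 i x => F.f1 i x

theorem eval_quad (i : ℤ) (l : List (Q.V i × Q.V (i + 1))) :
    F.eval (Term.quad Q i l) = (l.map fun p => A.mul (F.f1 i p.1) (F.f1 (i + 1) p.2)).sum := by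
  induction l with
  | nil => rfl
  | cons p l ih => rw [List.map_cons, List.sum_cons, ← ih]; rfl

theorem eval_eq {i j : ℤ} {x y : Term Q i j} (h : Rel Q x y) : F.eval x = F.eval y := by
  induction h with
  | refl x => rfl
  | symm _ h => exact h.symm
  | trans _ _ h h' => exact h.trans h'
  | add_congr _ _ h h' => simp only [eval, h, h']
  | neg_congr _ h => simp only [eval, h]
  | mul_congr _ _ h h' => simp only [eval, h, h']
  | add_assoc x y z => exact _root_.add_assoc _ _ _
  | add_comm x y => exact _root_.add_comm _ _
  | zero_add x => exact _root_.zero_add _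
  | neg_add x => exact neg_add_cancel _
  | mul_assoc x y z => exact A.mul_assoc _ _ _
  | add_mul x y z => simp [eval]
  | mul_add x y z => simp [eval]
  | one_mul x => simp [eval, F.f0_one, A.e_mul]
  | mul_one x => simp [eval, F.f0_one, A.mul_e]
  | deg0_add a b => exact map_add _ _ _
  | deg0_mul a b => exact F.f0_mul _ _ _
  | deg1_add x y => exact map_add _ _ _
  | deg1_left a x => exact F.f1_left _ _ _
  | deg1_right x b => exact F.f1_right _ _ _
  | quad l hl => rw [eval_quad]; exact F.f1_rel _ l hl

/-- The value of `F` on the classes of formal expressions. -/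
def compEval (i j : ℤ) : Comp Q i j → A.A i j :=
  Quotient.lift F.eval fun _ _ h => F.eval_eq h

/-- The morphism of `ℤ`-algebras determined by the images of the generators. -/
def lift : Q.toZAlgebra.Hom A where
  map i j :=
    { toFun := F.compEval i j
      map_add' := by rintro ⟨x⟩ ⟨y⟩; rfl
      map_smul' := by
        rintro c ⟨x⟩
        -- Scalars act on a presented algebra through the degree-zero class of their image in `D i`.
        change A.mul (F.f0 i (algebraMap k _ c)) (F.eval x) = c • F.eval x
        rw [F.f0_algebraMap, map_smul, LinearMap.smul_apply, A.e_mul] }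
  map_e i := F.f0_one i
  map_mul := by rintro i j l ⟨x⟩ ⟨y⟩; rfl

end Rep

/-- Morphisms out of a presented `ℤ`-algebra are determined on the generators. -/
theorem hom_ext {Q : QuadData.{w, v} k} {A : ZAlgebra.{w, v} k} {f g : Q.toZAlgebra.Hom A}
    (h0 : ∀ i d, f.map i i (Q.gen0 i d) = g.map i i (Q.gen0 i d))
    (h1 : ∀ i x, f.map i (i + 1) (Q.gen1 i x) = g.map i (i + 1) (Q.gen1 i x))
    (i j : ℤ) (c : Q.toZAlgebra.A i j) : f.map i j c = g.map i j c := by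
  induction c using Quotient.inductionOn with | _ x
  induction x with
  | zero i j => exact (map_zero (f.map i j)).trans (map_zero (g.map i j)).symm
  | @add i j x y hx hy =>
    exact (map_add (f.map i j) (cls Q x) (cls Q y)).trans
      ((congrArg₂ (· + ·) hx hy).trans (map_add (g.map i j) (cls Q x) (cls Q y)).symm)
  | @neg i j x hx =>
    exact (map_neg (f.map i j) (cls Q x)).trans
      ((congrArg Neg.neg hx).trans (map_neg (g.map i j) (cls Q x)).symm)
  | mul x y hx hy =>
    exact (f.map_mul (cls Q x) (cls Q y)).trans
      ((congrArg₂ (fun a b => A.mul a b) hx hy).trans (g.map_mul (cls Q x) (cls Q y)).symm)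
  | deg0 i d => exact h0 i d
  | deg1 i x => exact h1 i x

/-- A presented `ℤ`-algebra vanishes in negative degrees, and consists of the classes of the
generators in degrees `0` and `1`. -/
theorem comp_low_degree (Q : QuadData.{w, v} k) (i j : ℤ) (c : Comp Q i j) :
    (j < i → c = 0) ∧ (j = i → ∃ d, HEq c (Q.gen0 i d)) ∧
      (j = i + 1 → ∃ x, HEq c (Q.gen1 i x)) := by
  have g1z : ∀ i, Q.gen1 i 0 = 0 := fun i => by
    have h : Q.gen1 i (0 + 0) = Q.gen1 i 0 + Q.gen1 i 0 := cls_eq Q (.deg1_add 0 0)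
    rw [add_zero] at h
    exact left_eq_add.mp h
  induction c using Quotient.inductionOn with | _ x
  change (_ → cls Q x = 0) ∧ (_ → ∃ d, HEq (cls Q x) _) ∧ (_ → ∃ y, HEq (cls Q x) _)
  -- The induction runs over terms with arbitrary endpoints, so the degree enters as an equation
  -- between the endpoints and the classes are compared by `HEq`.
  induction x with
  | zero i j =>
    refine ⟨fun _ => rfl, ?_, ?_⟩
    · rintro rfl; exact ⟨0, heq_of_eq (Q.gen0_zero j).symm⟩
    · rintro rfl; exact ⟨0, heq_of_eq (g1z i).symm⟩
  | @add i j x y hx hy =>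
    refine ⟨fun h => ?_, ?_, ?_⟩
    · change cls Q x + cls Q y = 0
      rw [hx.1 h, hy.1 h, add_zero]
    · rintro rfl
      obtain ⟨a, ha⟩ := hx.2.1 rfl
      obtain ⟨b, hb⟩ := hy.2.1 rfl
      refine ⟨a + b, heq_of_eq ?_⟩
      rw [gen0_add, ← eq_of_heq ha, ← eq_of_heq hb]; rfl
    · rintro rfl
      obtain ⟨a, ha⟩ := hx.2.2 rfl
      obtain ⟨b, hb⟩ := hy.2.2 rfl
      refine ⟨a + b, heq_of_eq ?_⟩
      have : Q.gen1 i (a + b) = Q.gen1 i a + Q.gen1 i b := cls_eq Q (.deg1_add a b)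
      rw [this, ← eq_of_heq ha, ← eq_of_heq hb]; rfl
  | @neg i j x hx =>
    refine ⟨fun h => ?_, ?_, ?_⟩
    · change -cls Q x = 0
      rw [hx.1 h, neg_zero]
    · rintro rfl
      obtain ⟨a, ha⟩ := hx.2.1 rfl
      refine ⟨-a, heq_of_eq ?_⟩
      change -cls Q x = _
      rw [neg_eq_iff_add_eq_zero, eq_of_heq ha, ← gen0_add, add_neg_cancel, gen0_zero]
    · rintro rfl
      obtain ⟨a, ha⟩ := hx.2.2 rfl
      refine ⟨-a, heq_of_eq ?_⟩
      have : Q.gen1 i (a + -a) = Q.gen1 i a + Q.gen1 i (-a) := cls_eq Q (.deg1_add a (-a))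
      change -cls Q x = _
      rw [neg_eq_iff_add_eq_zero, eq_of_heq ha, ← this, add_neg_cancel, g1z]
  | @mul i j l x y hx hy =>
    -- A factor of negative degree kills the product. Otherwise the degrees split as 0 + 0, 0 + 1 or
    -- 1 + 0, and the product is absorbed by the ring or bimodule structure.
    have left : j < i → cls Q (x.mul y) = 0 := fun h => by
      change cmul Q (cls Q x) (cls Q y) = 0
      rw [hx.1 h, czero_mul]
    have right : l < j → cls Q (x.mul y) = 0 := fun h => by
      change cmul Q (cls Q x) (cls Q y) = 0
      rw [hy.1 h, cmul_zero]
    refine ⟨fun h => ?_, ?_, ?_⟩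
    · rcases lt_or_ge j i with h' | h'
      · exact left h'
      · exact right (by omega)
    · rintro rfl
      rcases lt_trichotomy j l with h' | rfl | h'
      · exact ⟨0, heq_of_eq ((left h').trans (Q.gen0_zero _).symm)⟩
      · obtain ⟨a, ha⟩ := hx.2.1 rfl
        obtain ⟨b, hb⟩ := hy.2.1 rfl
        refine ⟨a * b, heq_of_eq ?_⟩
        rw [gen0_mul, ← eq_of_heq ha, ← eq_of_heq hb]; rfl
      · exact ⟨0, heq_of_eq ((right h').trans (Q.gen0_zero _).symm)⟩
    · rintro rfl
      rcases lt_trichotomy j i with h' | rfl | h'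
      · exact ⟨0, heq_of_eq ((left h').trans (g1z _).symm)⟩
      · obtain ⟨a, ha⟩ := hx.2.1 rfl
        obtain ⟨b, hb⟩ := hy.2.2 rfl
        refine ⟨a • b, heq_of_eq ?_⟩
        have : Q.gen1 j (a • b) = cmul Q (Q.gen0 j a) (Q.gen1 j b) := cls_eq Q (.deg1_left a b)
        rw [this, ← eq_of_heq ha, ← eq_of_heq hb]; rfl
      · rcases (show i + 1 ≤ j by omega).eq_or_lt with rfl | h''
        · obtain ⟨a, ha⟩ := hx.2.2 rfl
          obtain ⟨b, hb⟩ := hy.2.1 rfl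
          refine ⟨op b • a, heq_of_eq ?_⟩
          have : Q.gen1 i (op b • a) = cmul Q (Q.gen1 i a) (Q.gen0 (i + 1) b) :=
            cls_eq Q (.deg1_right a b)
          rw [this, ← eq_of_heq ha, ← eq_of_heq hb]; rfl
        · exact ⟨0, heq_of_eq ((right h'').trans (g1z _).symm)⟩
  | deg0 i d => exact ⟨fun h => by omega, fun _ => ⟨d, HEq.rfl⟩, fun h => by omega⟩
  | deg1 i x => exact ⟨fun h => by omega, fun h => by omega, fun _ => ⟨x, HEq.rfl⟩⟩

theorem gen0_surjective (Q : QuadData.{w, v} k) (i : ℤ) : Function.Surjective (Q.gen0 i) :=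
  fun c => ((Q.comp_low_degree i i c).2.1 rfl).imp fun _ h => (eq_of_heq h).symm

theorem gen1_surjective (Q : QuadData.{w, v} k) (i : ℤ) : Function.Surjective (Q.gen1 i) :=
  fun c => ((Q.comp_low_degree i (i + 1) c).2.2 rfl).imp fun _ h => (eq_of_heq h).symm

/-- An isomorphism of quadratic data. -/
structure Equiv (Q Q' : QuadData.{w, v} k) where
  d : ∀ i, Q.D i ≃ₐ[k] Q'.D i
  v : ∀ i, Q.V i ≃+ Q'.V i
  left : ∀ i (a : Q.D i) (x : Q.V i), v i (a • x) = d i a • v i x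
  right : ∀ i (b : Q.D (i + 1)) (x : Q.V i), v i (op b • x) = op (d (i + 1) b) • v i x
  -- Lists of pairs represent tensors here, as in the constructor `Rel.quad`; no induced map of
  -- tensor products is needed.
  rel_iff : ∀ i (l : List (Q.V i × Q.V (i + 1))),
    (l.map fun p => BTensor.tmul (Q.D (i + 1)) p.1 p.2).sum ∈ Q.rel i ↔
    (l.map fun p => BTensor.tmul (Q'.D (i + 1)) (v i p.1) (v (i + 1) p.2)).sum ∈ Q'.rel i

namespace Equiv

variable {Q Q' : QuadData.{w, v} k}

def symm (E : Equiv Q Q') : Equiv Q' Q where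
  d i := (E.d i).symm
  v i := (E.v i).symm
  left i a x := (E.v i).injective (by simp [E.left])
  right i b x := (E.v i).injective (by simp [E.right])
  rel_iff i l := by simpa [Function.comp_def] using
      (E.rel_iff i (l.map fun p => ((E.v i).symm p.1, (E.v (i + 1)).symm p.2))).symm

theorem gen_quad_sum (Q : QuadData.{w, v} k) (i : ℤ) (l : List (Q.V i × Q.V (i + 1))) :
    (l.map fun p => cmul Q (Q.gen1 i p.1) (Q.gen1 (i + 1) p.2)).sum = cls Q (Term.quad Q i l) := by
  induction l with
  | nil => rfl
  | cons p l ih => rw [List.map_cons, List.sum_cons, ih]; rfl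

/-- The induced images of the generators. -/
def rep (E : Equiv Q Q') : Rep Q Q'.toZAlgebra where
  f0 i := AddMonoidHom.mk' (fun d => Q'.gen0 i (E.d i d)) fun a b => by
    rw [map_add]; exact Q'.gen0_add i _ _
  f1 i := AddMonoidHom.mk' (fun x => Q'.gen1 i (E.v i x)) fun a b => by
    rw [map_add]; exact cls_eq Q' (.deg1_add _ _)
  f0_algebraMap i c := by
    change Q'.gen0 i (E.d i (algebraMap k _ c)) =
      cmul Q' (Q'.gen0 i (algebraMap k _ c)) (Q'.gen0 i 1)
    rw [AlgEquiv.commutes, cmul_one]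
  f0_mul i a b := by
    change Q'.gen0 i (E.d i (a * b)) = _
    rw [map_mul]; exact Q'.gen0_mul i _ _
  f1_left i a x := by
    change Q'.gen1 i (E.v i (a • x)) = _
    rw [E.left]; exact cls_eq Q' (.deg1_left _ _)
  f1_right i x b := by
    change Q'.gen1 i (E.v i (op b • x)) = _
    rw [E.right]; exact cls_eq Q' (.deg1_right _ _)
  f1_rel i l hl := by
    have h := gen_quad_sum Q' i (l.map fun p => (E.v i p.1, E.v (i + 1) p.2))
    rw [List.map_map] at h
    refine h.trans (cls_eq Q' (.quad _ ?_))
    rw [List.map_map]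
    exact (E.rel_iff i l).1 hl

/-- Isomorphic quadratic data present isomorphic `ℤ`-algebras. -/
theorem isIso_lift (E : Equiv Q Q') : E.rep.lift.IsIso := fun i j => by
  refine Function.bijective_iff_has_inverse.2 ⟨E.symm.rep.lift.map i j, fun c => ?_, fun c => ?_⟩
  -- Both composites are compared on generators with the identity morphism, written out as `g`.
  · refine hom_ext (f := E.symm.rep.lift.comp E.rep.lift)
      (g := ⟨fun _ _ => LinearMap.id, fun _ => rfl, fun _ _ => rfl⟩)
      (fun i d => ?_) (fun i x => ?_) i j c
    · exact congrArg (Q.gen0 i) ((E.d i).symm_apply_apply d)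
    · exact congrArg (Q.gen1 i) ((E.v i).symm_apply_apply x)
  · refine hom_ext (f := E.rep.lift.comp E.symm.rep.lift)
      (g := ⟨fun _ _ => LinearMap.id, fun _ => rfl, fun _ _ => rfl⟩)
      (fun i d => ?_) (fun i x => ?_) i j c
    · exact congrArg (Q'.gen0 i) ((E.d i).apply_symm_apply d)
    · exact congrArg (Q'.gen1 i) ((E.v i).apply_symm_apply x)

end Equiv

end QuadData

/-! ### The morphism to the orbit algebra -/

section Orbit

variable (k : Type w) [Field k] {C : Type u} [Category.{v} C] [Abelian C] [Linear k C]

theorem compMap_list_sum {X Y Z : C} (l : List ((Y ⟶ Z) × (X ⟶ Y))) :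
    compMap X Y Z (l.map fun p => BTensor.tmul (End Y) p.1 p.2).sum =
      (l.map fun p => p.2 ≫ p.1).sum := by
  rw [map_list_sum, List.map_map]; rfl

/-- The generators of the noncommutative symmetric algebra of a sequence, as elements of the orbit
algebra. -/
def orbitRep (L : ℤ → C) : (ncSymSeqData k L).Rep (orbitAlgebra k L) where
  f0 _ := AddMonoidHom.id _
  f1 _ := AddMonoidHom.id _
  f0_algebraMap _ _ := rfl
  f0_mul _ _ _ := rfl
  f1_left _ _ _ := rfl
  f1_right _ _ _ := rfl
  f1_rel i l hl := (compMap_list_sum (X := L (-(i + 1 + 1))) (Y := L (-(i + 1))) l).symm.trans hl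

theorem isInducedByComposition_lift (L : ℤ → C) :
    IsInducedByComposition k L (orbitRep k L).lift :=
  ⟨fun _ _ => rfl, fun _ _ => rfl⟩

/-- The map `gen0` is surjective and becomes the identity after evaluation in the orbit algebra, so
both maps are bijective. -/
theorem orbitRep_lift_bijective_zero (L : ℤ → C) (i : ℤ) :
    Function.Bijective ((orbitRep k L).lift.map i i) := by
  refine ⟨fun a b h => ?_, fun d => ⟨(ncSymSeqData k L).gen0 i d, rfl⟩⟩
  obtain ⟨a, rfl⟩ := (ncSymSeqData k L).gen0_surjective i a
  obtain ⟨b, rfl⟩ := (ncSymSeqData k L).gen0_surjective i b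
  exact congrArg _ (show a = b from h)

theorem orbitRep_lift_bijective_one (L : ℤ → C) (i : ℤ) :
    Function.Bijective ((orbitRep k L).lift.map i (i + 1)) := by
  refine ⟨fun a b h => ?_, fun d => ⟨(ncSymSeqData k L).gen1 i d, rfl⟩⟩
  obtain ⟨a, rfl⟩ := (ncSymSeqData k L).gen1_surjective i a
  obtain ⟨b, rfl⟩ := (ncSymSeqData k L).gen1_surjective i b
  exact congrArg _ (show a = b from h)

end Orbit

/-! ### Isomorphisms of bimodules -/

variable {k : Type w} [Field k]

/-- An isomorphism of bimodules, semilinear over isomorphisms of the coefficient rings. -/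
structure BimodIso (B B' : Bimod.{w, v} k) where
  l : B.L ≃ₐ[k] B'.L
  r : B.R ≃ₐ[k] B'.R
  m : B.M ≃+ B'.M
  left : ∀ (a : B.L) (x : B.M), m (a • x) = l a • m x
  right : ∀ (b : B.R) (x : B.M), m (op b • x) = op (r b) • m x

namespace BimodIso

variable {B B' B'' : Bimod.{w, v} k}

def refl (B : Bimod.{w, v} k) : BimodIso B B :=
  ⟨.refl, .refl, .refl _, fun _ _ => rfl, fun _ _ => rfl⟩

def trans (e : BimodIso B B') (e' : BimodIso B' B'') : BimodIso B B'' where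
  l := e.l.trans e'.l
  r := e.r.trans e'.r
  m := e.m.trans e'.m
  left a x := by simp [e.left, e'.left]
  right b x := by simp [e.right, e'.right]

def symm (e : BimodIso B B') : BimodIso B' B where
  l := e.l.symm
  r := e.r.symm
  m := e.m.symm
  left a x := e.m.injective (by simp [e.left])
  right b x := e.m.injective (by simp [e.right])

theorem symm_left (e : BimodIso B B') (a : B'.L) (x : B'.M) :
    e.m.symm (a • x) = e.l.symm a • e.m.symm x := e.symm.left a x

theorem symm_right (e : BimodIso B B') (a : B'.R) (x : B'.M) :
    e.m.symm (op a • x) = op (e.r.symm a) • e.m.symm x := e.symm.right a x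

/-- The map induced on right duals. -/
def rdualMap (e : BimodIso B B') (ψ : B.M →ₗ[B.Rᵐᵒᵖ] B.R) : B'.M →ₗ[B'.Rᵐᵒᵖ] B'.R where
  toFun y := e.r (ψ (e.m.symm y))
  map_add' x y := by simp
  map_smul' a x := by
    induction a using MulOpposite.rec' with | _ a
    rw [e.symm_right, map_smul, op_smul_eq_mul, map_mul, AlgEquiv.apply_symm_apply]
    rfl

/-- The map induced on left duals. -/
def ldualMap (e : BimodIso B B') (φ : B.M →ₗ[B.L] B.L) : B'.M →ₗ[B'.L] B'.L where
  toFun y := e.l (φ (e.m.symm y))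
  map_add' x y := by simp
  map_smul' a x := by
    rw [e.symm_left, map_smul, smul_eq_mul, map_mul, AlgEquiv.apply_symm_apply]
    rfl

theorem rdualMap_apply (e : BimodIso B B') (ψ : B.M →ₗ[B.Rᵐᵒᵖ] B.R) (x : B.M) :
    e.rdualMap ψ (e.m x) = e.r (ψ x) :=
  congrArg (fun z => e.r (ψ z)) (e.m.symm_apply_apply x)

theorem ldualMap_apply (e : BimodIso B B') (φ : B.M →ₗ[B.L] B.L) (x : B.M) :
    e.ldualMap φ (e.m x) = e.l (φ x) :=
  congrArg (fun z => e.l (φ z)) (e.m.symm_apply_apply x)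

def rdual (e : BimodIso B B') : BimodIso B.rdual B'.rdual where
  l := e.r
  r := e.l
  m :=
    { toFun := e.rdualMap
      invFun := e.symm.rdualMap
      left_inv := fun ψ => LinearMap.ext fun x => by
        change e.r.symm (e.r (ψ (e.m.symm (e.m x)))) = ψ x
        simp
      right_inv := fun ψ => LinearMap.ext fun x => by
        change e.r (e.r.symm (ψ (e.m (e.m.symm x)))) = ψ x
        simp
      map_add' := fun φ ψ => LinearMap.ext fun x => map_add e.r _ _ }
  left a ψ := LinearMap.ext fun x => map_mul e.r _ _
  right b ψ := LinearMap.ext fun x => by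
    change e.r (ψ (b • e.m.symm x)) = e.r (ψ (e.m.symm (e.l b • x)))
    rw [e.symm_left, AlgEquiv.symm_apply_apply]

def ldual (e : BimodIso B B') : BimodIso B.ldual B'.ldual where
  l := e.r
  r := e.l
  m :=
    { toFun := e.ldualMap
      invFun := e.symm.ldualMap
      left_inv := fun φ => LinearMap.ext fun x => by
        change e.l.symm (e.l (φ (e.m.symm (e.m x)))) = φ x
        simp
      right_inv := fun φ => LinearMap.ext fun x => by
        change e.l (e.l.symm (φ (e.m (e.m.symm x)))) = φ x
        simp
      map_add' := fun φ ψ => LinearMap.ext fun x => map_add e.l _ _ }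
  left a φ := LinearMap.ext fun x => by
    change e.l (φ (op a • e.m.symm x)) = e.l (φ (e.m.symm (op (e.r a) • x)))
    rw [e.symm_right, AlgEquiv.symm_apply_apply]
  right b φ := LinearMap.ext fun x => map_mul e.l _ _

end BimodIso

/-! ### Bases and biduals -/

/-- The coordinate functionals span the dual as a right module; the coefficients are the values on
the basis. -/
theorem dual_eq_sum {D M : Type v} [Ring D] [AddCommGroup M] [Module D M] {ι : Type} [Fintype ι]
    (b : Module.Basis ι D M) (φ : M →ₗ[D] D) :
    φ = ∑ s, op (φ (b s)) • (b.coord s : M →ₗ[D] D) := by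
  refine LinearMap.ext fun x => ?_
  rw [LinearMap.sum_apply]
  conv_lhs => rw [← b.sum_repr x, map_sum]
  exact Finset.sum_congr rfl fun s _ => map_smul φ _ _

namespace Bimod

variable (B : Bimod.{w, v} k) {ι : Type}

theorem eq_of_forall_ldual (b : Module.Basis ι B.L B.M) {x y : B.M}
    (h : ∀ φ : B.M →ₗ[B.L] B.L, φ x = φ y) : x = y :=
  b.ext_elem fun s => h (b.coord s)

variable [Fintype ι]

theorem sum_coord_smul (b : Module.Basis ι B.L B.M) (x : B.M) : ∑ s, b.coord s x • b s = x :=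
  b.sum_repr x

/-- The canonical map `M → (*M)^*`. -/
def bidualMap (x : B.M) : B.ldual.M →ₗ[B.Lᵐᵒᵖ] B.L where
  toFun φ := φ x
  map_add' _ _ := rfl
  map_smul' _ _ := rfl

/-- Coordinate functionals separate points, which gives injectivity. A functional f on the dual is
determined by its values on the dual basis, and ∑ f(b_s^*) b_s realises them. -/
theorem bidualMap_bijective (b : Module.Basis ι B.L B.M) : Function.Bijective B.bidualMap := by
  refine ⟨fun x y h => B.eq_of_forall_ldual b fun φ => LinearMap.congr_fun h φ, fun f => ?_⟩
  refine ⟨∑ s, f (b.coord s) • b s, LinearMap.ext fun φ => ?_⟩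
  change φ (∑ s, f (b.coord s) • b s) = f φ
  conv_rhs => rw [dual_eq_sum b φ, map_sum]
  rw [map_sum]
  refine Finset.sum_congr rfl fun s _ => ?_
  rw [map_smul]
  exact (map_smul f (op (φ (b s))) (b.coord s : B.M →ₗ[B.L] B.L)).symm

/-- The isomorphism `M ≅ (*M)^*`. -/
noncomputable def bidual (b : Module.Basis ι B.L B.M) : BimodIso B B.ldual.rdual where
  l := .refl
  r := .refl
  m := AddEquiv.ofBijective (AddMonoidHom.mk' B.bidualMap fun x y =>
    LinearMap.ext fun φ => map_add φ x y) (B.bidualMap_bijective b)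
  left a x := LinearMap.ext fun φ => map_smul φ a x
  right _ _ := rfl

end Bimod

/-! ### The canonical units -/

section BTensor

variable {D V W : Type v} [Ring D] [AddCommGroup V] [AddCommGroup W] [Module Dᵐᵒᵖ V] [Module D W]

/-- Pure tensors, as a biadditive map. -/
def BTensor.mk (D V W : Type v) [Ring D] [AddCommGroup V] [AddCommGroup W] [Module Dᵐᵒᵖ V]
    [Module D W] : V →+ W →+ BTensor D V W :=
  AddMonoidHom.mk' (fun x => AddMonoidHom.mk' (fun y => BTensor.tmul D x y) fun y y' => by
    unfold BTensor.tmul; rw [TensorProduct.tmul_add]; rfl) fun x x' => by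
    ext y
    change BTensor.tmul D (x + x') y = BTensor.tmul D x y + BTensor.tmul D x' y
    unfold BTensor.tmul; rw [TensorProduct.add_tmul]; rfl

theorem BTensor.mk_smul (x : V) (d : D) (y : W) :
    BTensor.mk D V W (op d • x) y = BTensor.mk D V W x (d • y) := by
  refine (QuotientAddGroup.eq_iff_sub_mem).2 (AddSubgroup.subset_closure ⟨x, d, y, rfl⟩)

theorem BTensor.induction {p : BTensor D V W → Prop} (h0 : p 0)
    (h1 : ∀ x y, p (BTensor.mk D V W x y)) (h2 : ∀ s t, p s → p t → p (s + t))
    (t : BTensor D V W) : p t := by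
  induction t using QuotientAddGroup.induction_on with | _ t
  induction t with
  | zero => exact h0
  | tmul x y => exact h1 x y
  | add s t hs ht => exact h2 _ _ hs ht

end BTensor

namespace Bimod

variable (B : Bimod.{w, v} k)

/-- The evaluation `*M ⊗ M → M` at `y`, `φ ⊗ x ↦ φ(y) x`. -/
def contractL (y : B.M) : BTensor B.L B.ldual.M B.M →+ B.M :=
  BTensor.lift (AddMonoidHom.mk' (fun φ : B.M →ₗ[B.L] B.L =>
      AddMonoidHom.mk' (fun x => φ y • x) fun x x' => smul_add _ _ _) fun φ φ' => by
        ext x; exact add_smul (φ y) (φ' y) x)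
    (fun φ d x => mul_smul (φ y) d x)

/-- The evaluation `M ⊗ M^* → M` at `y`, `x ⊗ ψ ↦ x ψ(y)`. -/
def contractR (y : B.M) : BTensor B.R B.M B.rdual.M →+ B.M :=
  BTensor.lift (AddMonoidHom.mk' (fun x =>
      AddMonoidHom.mk' (fun ψ : B.M →ₗ[B.Rᵐᵒᵖ] B.R => op (ψ y) • x) fun ψ ψ' =>
        add_smul (op (ψ y)) (op (ψ' y)) x) fun x x' => by
        ext ψ; exact smul_add (op (ψ y)) x x')
    (fun x d ψ => (mul_smul (op (ψ y)) (op d) x).symm)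

theorem contractR_tmul (y x : B.M) (ψ : B.M →ₗ[B.Rᵐᵒᵖ] B.R) :
    B.contractR y (BTensor.tmul B.R (W := B.rdual.M) x ψ) = op (ψ y) • x := rfl

variable {B} {ι : Type} [Fintype ι]

/-- Moving coefficients across the tensor sign writes every tensor as ∑ b_s^* ⊗ x_s, and contraction
at b_s reads off x_s. So tensors are determined by their contractions. -/
theorem eq_sum_contractL (b : Module.Basis ι B.L B.M) (t : BTensor B.L B.ldual.M B.M) :
    t = ∑ s, BTensor.mk B.L B.ldual.M B.M (b.coord s) (B.contractL (b s) t) := by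
  induction t using BTensor.induction with
  | h0 => simp
  | h1 φ x =>
    conv_lhs => rw [dual_eq_sum b φ, map_sum, AddMonoidHom.finsetSum_apply]
    exact Finset.sum_congr rfl fun s _ => BTensor.mk_smul (V := B.ldual.M) _ _ _
  | h2 s t hs ht =>
    conv_lhs => rw [hs, ht]
    simp [Finset.sum_add_distrib]

/-- An element of `*M ⊗ M` lies in the image of the unit if and only if it acts on `M` as the right
multiplication by a scalar. -/
theorem mem_unitL_iff {n : ℕ} (b : Module.Basis (Fin n) B.L B.M) (t : BTensor B.L B.ldual.M B.M) :
    t ∈ B.unitL ↔ ∃ d : B.R, ∀ y, B.contractL y t = op d • y := by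
  -- Proved for every basis, since membership in the image of the unit supplies a basis of its own.
  have key : ∀ {n : ℕ} (b : Module.Basis (Fin n) B.L B.M) (d : B.R) (y : B.M),
      B.contractL y (∑ s, BTensor.tmul B.L (V := B.ldual.M)
        (B.ldual.modL.smul d (b.coord s)) (b s)) = op d • y := fun b d y => by
    rw [map_sum]
    exact B.sum_coord_smul b (op d • y)
  constructor
  · rintro ⟨n, b, d, rfl⟩
    exact ⟨d, key b d⟩
  · rintro ⟨d, h⟩
    refine ⟨n, b, d, ?_⟩
    refine (eq_sum_contractL b t).trans (Eq.trans ?_ (eq_sum_contractL b _).symm)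
    exact Finset.sum_congr rfl fun s _ => by rw [h, key]

theorem rdual_eq_sum (b : Module.Basis ι B.Rᵐᵒᵖ B.M) (f : ι → B.rdual.M)
    (hf : ∀ s x, f s x = (b.repr x s).unop) (ψ : B.M →ₗ[B.Rᵐᵒᵖ] B.R) :
    ψ = ∑ s, ψ (b s) • f s := by
  refine LinearMap.ext fun x => ?_
  conv_lhs => rw [← b.sum_repr x, map_sum]
  refine Eq.trans (Finset.sum_congr rfl fun s _ => ?_) (LinearMap.sum_apply _ _ _).symm
  rw [map_smul]
  change _ = ψ (b s) * f s x
  rw [hf]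
  rfl

theorem eq_sum_contractR (b : Module.Basis ι B.Rᵐᵒᵖ B.M) (f : ι → B.rdual.M)
    (hf : ∀ s x, f s x = (b.repr x s).unop) (t : BTensor B.R B.M B.rdual.M) :
    t = ∑ s, BTensor.mk B.R B.M B.rdual.M (B.contractR (b s) t) (f s) := by
  induction t using BTensor.induction with
  | h0 => simp
  | h1 x ψ =>
    conv_lhs => rw [rdual_eq_sum b f hf ψ, map_sum]
    exact Finset.sum_congr rfl fun s _ => (BTensor.mk_smul (W := B.rdual.M) _ _ _).symm
  | h2 s t hs ht =>
    conv_lhs => rw [hs, ht]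
    simp [Finset.sum_add_distrib]

/-- An element of `M ⊗ M^*` lies in the image of the unit if and only if it acts on `M` as the left
multiplication by a scalar. -/
theorem mem_unitR_iff {n : ℕ} (b : Module.Basis (Fin n) B.Rᵐᵒᵖ B.M)
    (t : BTensor B.R B.M B.rdual.M) :
    t ∈ B.unitR ↔ ∃ d : B.L, ∀ y, B.contractR y t = d • y := by
  have key : ∀ {n : ℕ} (b : Module.Basis (Fin n) B.Rᵐᵒᵖ B.M) (f : Fin n → B.rdual.M),
      (∀ s x, f s x = (b.repr x s).unop) → ∀ (d : B.L) (y : B.M),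
      B.contractR y (∑ s, BTensor.tmul B.R (W := B.rdual.M) (d • b s) (f s)) = d • y :=
    fun b f hf d y => by
      rw [map_sum]
      conv_rhs => rw [← b.sum_repr y, Finset.smul_sum]
      refine Finset.sum_congr rfl fun s _ => ?_
      rw [contractR_tmul, hf, op_unop, ← smul_comm]
  constructor
  · rintro ⟨n, b, f, d, hf, rfl⟩
    exact ⟨d, key b f hf d⟩
  · rintro ⟨d, h⟩
    -- The coordinates take values in `B.Rᵐᵒᵖ`, while the right dual takes values in `B.R`.
    let f : Fin n → B.rdual.M := fun s =>
      { toFun := fun x => (b.repr x s).unop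
        map_add' := fun x y => by simp
        map_smul' := fun a x => by simp }
    have hf : ∀ s x, f s x = (b.repr x s).unop := fun _ _ => rfl
    refine ⟨n, b, f, d, hf, ?_⟩
    refine (eq_sum_contractR b f hf t).trans (Eq.trans ?_ (eq_sum_contractR b f hf _).symm)
    exact Finset.sum_congr rfl fun s _ => by rw [h, key b f hf]

end Bimod

/-! ### Finite-dimensional bimodules over division rings -/

/-- Every nonzero element is invertible, and `1 ≠ 0`. -/
def IsDivision (D : Type v) [Ring D] : Prop := Nontrivial D ∧ ∀ d : D, d ≠ 0 → IsUnit d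

theorem IsDivision.of_ringEquiv {D D' : Type v} [Ring D] [Ring D'] (h : IsDivision D)
    (e : D' ≃+* D) : IsDivision D' := by
  have := h.1
  refine ⟨e.toEquiv.nontrivial, fun d hd => ?_⟩
  have := (h.2 (e d) (by simpa using hd)).map e.symm
  simpa using this

theorem IsDivision.exists_basis {D : Type v} [Ring D] (h : IsDivision D) (M : Type v)
    [AddCommGroup M] [Module D M] [Module.Finite D M] :
    ∃ n : ℕ, Nonempty (Module.Basis (Fin n) D M) := by
  have := h.1
  let _ : DivisionRing D := DivisionRing.ofIsUnitOrEqZero fun d => by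
    by_cases hd : d = 0
    · exact .inr hd
    · exact .inl (h.2 d hd)
  exact ⟨_, ⟨Module.finBasis D M⟩⟩

theorem IsDivision.op {D : Type v} [Ring D] (h : IsDivision D) : IsDivision Dᵐᵒᵖ := by
  have := h.1
  refine ⟨inferInstance, fun d hd => ?_⟩
  have := (h.2 d.unop (by simpa using hd)).op
  simpa using this

/-- A bimodule over division rings that is finite-dimensional on both sides. -/
structure Bimod.FiniteDim (B : Bimod.{w, v} k) : Prop where
  divL : IsDivision B.L
  divR : IsDivision B.R
  finL : Module.Finite B.L B.M
  finR : Module.Finite B.Rᵐᵒᵖ B.M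

theorem BimodIso.finiteDim {B B' : Bimod.{w, v} k} (e : BimodIso B B') (h : B'.FiniteDim) :
    B.FiniteDim where
  divL := h.divL.of_ringEquiv e.l.toRingEquiv
  divR := h.divR.of_ringEquiv e.r.toRingEquiv
  finL := by
    have := h.finL
    let σ : B'.L →+* B.L := e.l.symm.toRingEquiv
    have : RingHomSurjective σ := ⟨e.l.symm.surjective⟩
    -- The inverse is only semilinear over the isomorphism of coefficient rings, but finiteness
    -- passes along surjective semilinear maps too.
    let f : B'.M →ₛₗ[σ] B.M :=
      { toFun := e.m.symm, map_add' := map_add _, map_smul' := e.symm_left }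
    exact Module.Finite.of_surjective f e.m.symm.surjective
  finR := by
    have := h.finR
    let σ : B'.Rᵐᵒᵖ →+* B.Rᵐᵒᵖ := (RingEquiv.op e.r.symm.toRingEquiv : B'.Rᵐᵒᵖ ≃+* B.Rᵐᵒᵖ)
    have : RingHomSurjective σ := ⟨(RingEquiv.op e.r.symm.toRingEquiv).surjective⟩
    let f : B'.M →ₛₗ[σ] B.M :=
      { toFun := e.m.symm, map_add' := map_add _, map_smul' := fun a => e.symm_right a.unop }
    exact Module.Finite.of_surjective f e.m.symm.surjective

/-! ### Relations under isomorphisms -/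

/-- The contraction criterion, transported along `e`. The right-hand side is stated inside `B'`
without tensor products, in the shape of the criterion for the kernel of composition. -/
theorem BimodIso.mem_unitL_iff {B B' : Bimod.{w, v} k} (h : B.FiniteDim) (e : BimodIso B B')
    (l : List (B.ldual.M × B.M)) :
    (l.map fun p => BTensor.tmul B.L (V := B.ldual.M) p.1 p.2).sum ∈ B.unitL ↔
      ∃ d : B'.R, ∀ y, (l.map fun p => e.ldualMap p.1 y • e.m p.2).sum = op d • y := by
  have := h.finL
  obtain ⟨n, ⟨b⟩⟩ := h.divL.exists_basis B.M
  rw [Bimod.mem_unitL_iff b, e.r.surjective.exists]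
  refine exists_congr fun d => ?_
  rw [e.m.surjective.forall]
  refine forall_congr' fun y => ?_
  rw [← e.right, ← e.m.injective.eq_iff, map_list_sum, map_list_sum, List.map_map, List.map_map]
  refine Eq.congr (congrArg List.sum (List.map_congr_left fun p _ => ?_)) rfl
  rw [ldualMap_apply, ← e.left]
  rfl

theorem BimodIso.mem_unitR_iff {B B' : Bimod.{w, v} k} (h : B.FiniteDim) (e : BimodIso B B')
    (l : List (B.M × B.rdual.M)) :
    (l.map fun p => BTensor.tmul B.R (W := B.rdual.M) p.1 p.2).sum ∈ B.unitR ↔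
      ∃ d : B'.L, ∀ y, (l.map fun p => op (e.rdualMap p.2 y) • e.m p.1).sum = d • y := by
  have := h.finR
  obtain ⟨n, ⟨b⟩⟩ := h.divR.op.exists_basis B.M
  rw [Bimod.mem_unitR_iff b, e.l.surjective.exists]
  refine exists_congr fun d => ?_
  rw [e.m.surjective.forall]
  refine forall_congr' fun y => ?_
  rw [← e.left, ← e.m.injective.eq_iff, map_list_sum, map_list_sum, List.map_map, List.map_map]
  refine Eq.congr (congrArg List.sum (List.map_congr_left fun p _ => ?_)) rfl
  rw [rdualMap_apply, ← e.right]
  rfl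

/-! ### Consequences of an Euler sequence -/

namespace EulerSeq

variable {C : Type u} [Category.{v} C] [Abelian C] {X Y Z : C} (E : EulerSeq X Y Z)

theorem _root_.NCSym.TensorObj.hom_ext {N : Type v} [AddCommGroup N] [Module (End Y)ᵐᵒᵖ N]
    (T : TensorObj Y N) {W : C} {f g : T.obj ⟶ W} (h : ∀ n, T.ten n ≫ f = T.ten n ≫ g) : f = g :=
  (T.bij W).1 (LinearMap.ext h)

/-- Since `E.p` is epi and the morphisms `E.T.ten φ` are jointly epi, an endomorphism of `Z` is
determined by its composites with all `E.canon φ`. The algebra homomorphism properties of `Phi`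
follow from this. -/
theorem Phi_unique {d : End X} {z : End Z}
    (h : ∀ φ, E.canon (HomDual.act d Y φ) = E.canon φ ≫ z) : E.Phi d = z := by
  have : Epi E.p := E.shortExact.epi_g
  rw [← cancel_epi E.p]
  refine E.T.hom_ext fun φ => ?_
  rw [← Category.assoc, ← Category.assoc]
  exact (E.canon_act d φ).symm.trans (h φ)

theorem Phi_add (d e : End X) : E.Phi (d + e) = E.Phi d + E.Phi e := by
  refine E.Phi_unique fun φ => ?_
  have h : HomDual.act (d + e) Y φ = HomDual.act d Y φ + HomDual.act e Y φ :=
    LinearMap.ext fun h => (congrArg φ (Preadditive.add_comp _ _ _ d e h)).trans (map_add φ _ _)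
  rw [h, map_add, canon_act, canon_act]
  exact (Preadditive.comp_add _ _ _ _ _ _).symm

theorem Phi_mul (d e : End X) : E.Phi (d * e) = E.Phi d * E.Phi e := by
  refine E.Phi_unique fun φ => ?_
  have h : HomDual.act (d * e) Y φ = HomDual.act d Y (HomDual.act e Y φ) :=
    LinearMap.ext fun h => congrArg φ (Category.assoc e d h)
  rw [h, canon_act, canon_act]
  exact Category.assoc _ _ _

/-- A scalar acts on the left dual in the same way from the left and from the right, and `E.canon`
is right linear. -/
theorem Phi_algebraMap (k : Type w) [Field k] [Linear k C] (c : k) :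
    E.Phi (algebraMap k (End X) c) = algebraMap k (End Z) c := by
  refine E.Phi_unique fun φ => ?_
  have h : HomDual.act (algebraMap k (End X) c) Y φ = op (algebraMap k (End Y) c) • φ :=
    LinearMap.ext fun h => by
      change φ (op (algebraMap k (End X) c) • h) = φ h * algebraMap k (End Y) c
      rw [algebraMap_end_op_smul, ← algebraMap_end_smul, map_smul, smul_eq_mul, Algebra.commutes]
  rw [h, map_smul, algebraMap_end_op_smul]
  exact (algebraMap_end_smul k c _).symm

/-- The isomorphism `*Hom(X, Y) ≅ Hom(Y, Z)` of bimodules. -/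
noncomputable def canonIso (k : Type w) [Field k] [Linear k C] (hΦ : Function.Bijective E.Phi)
    (hc : Function.Bijective E.canon) : BimodIso (homBimod k X Y).ldual (homBimod k Y Z) where
  l := AlgEquiv.ofBijective
    ({ toFun := E.Phi
       map_one' := by simpa using E.Phi_algebraMap k 1
       map_mul' := E.Phi_mul
       map_zero' := by simpa using E.Phi_algebraMap k 0
       map_add' := E.Phi_add
       commutes' := E.Phi_algebraMap k } : End X →ₐ[k] End Z) hΦ
  r := .refl
  m := AddEquiv.ofBijective E.canon hc
  left a φ := E.canon_act a φ
  right b φ := map_smul E.canon (op b) φ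

/-- Evaluation at `h : X ⟶ Y`, as a map `*Hom(X, Y) ⊗ Y ⟶ Y`. -/
noncomputable def evalAt (h : X ⟶ Y) : E.T.obj ⟶ Y :=
  E.T.desc
    { toFun := fun φ => (φ h : Y ⟶ Y)
      map_add' := fun _ _ => rfl
      map_smul' := fun _ _ => rfl }

theorem ten_evalAt (φ : HomDual X Y) (h : X ⟶ Y) : E.T.ten φ ≫ E.evalAt h = φ h :=
  E.T.ten_desc _ φ

theorem coev_evalAt (h : X ⟶ Y) : coev E.T E.basis ≫ E.evalAt h = h := by
  unfold coev
  rw [Preadditive.sum_comp]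
  simp only [Category.assoc, ten_evalAt]
  exact E.basis.sum_repr h

theorem hom_eq_of_evalAt {W : C} {f g : W ⟶ E.T.obj}
    (h : ∀ x, f ≫ E.evalAt x = g ≫ E.evalAt x) : f = g := by
  -- The object *Hom(X, Y) ⊗ Y is a direct sum of copies of Y indexed by the basis: the projections
  -- are evaluations at basis elements, the inclusions are tensoring with the dual basis.
  have hid : 𝟙 E.T.obj = ∑ s, E.evalAt (E.basis s) ≫ E.T.ten (E.basis.coord s) := by
    refine E.T.hom_ext fun φ => ?_
    rw [Category.comp_id, Preadditive.comp_sum]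
    simp only [← Category.assoc, ten_evalAt]
    conv_lhs => rw [dual_eq_sum E.basis φ, map_sum]
    exact Finset.sum_congr rfl fun s _ => map_smul E.T.ten _ _
  rw [← Category.comp_id f, ← Category.comp_id g, hid, Preadditive.comp_sum, Preadditive.comp_sum]
  simp only [← Category.assoc, h]

/-- The kernel of the composition `Hom(Y, Z) ⊗ Hom(X, Y) → Hom(X, Z)`. -/
theorem comp_eq_zero_iff (l : List (HomDual X Y × (X ⟶ Y))) :
    (l.map fun p => p.2 ≫ E.canon p.1).sum = 0 ↔
      ∃ d : End X, ∀ h : X ⟶ Y, (l.map fun p => p.1 h • p.2).sum = op d • h := by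
  -- The morphism attached to the tensor: following it by `E.p` gives the composition, following it
  -- by an evaluation gives the contraction.
  set f : X ⟶ E.T.obj := (l.map fun p => p.2 ≫ E.T.ten p.1).sum with hf
  have hp : (l.map fun p => p.2 ≫ E.canon p.1).sum = f ≫ E.p := by
    change _ = Preadditive.rightComp X E.p f
    rw [hf, map_list_sum, List.map_map]
    exact congrArg List.sum (List.map_congr_left fun p _ => (Category.assoc _ _ _).symm)
  have hev : ∀ h, (l.map fun p => p.1 h • p.2).sum = f ≫ E.evalAt h := fun h => by
    change _ = Preadditive.rightComp X (E.evalAt h) f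
    rw [hf, map_list_sum, List.map_map]
    refine congrArg List.sum (List.map_congr_left fun p _ => ?_)
    change _ = (p.2 ≫ E.T.ten p.1) ≫ E.evalAt h
    rw [Category.assoc, ten_evalAt]
    rfl
  rw [hp]
  simp only [hev]
  constructor
  · intro h
    have := E.shortExact.mono_f
    -- The scalar is the factorisation of f through the kernel η of `E.p`.
    refine ⟨E.shortExact.exact.lift f h, fun x => ?_⟩
    have h' : E.shortExact.exact.lift f h ≫ coev E.T E.basis = f := E.shortExact.exact.lift_f f h
    conv_lhs => rw [← h', Category.assoc, coev_evalAt]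
    rfl
  · rintro ⟨d, h⟩
    have : f = d ≫ coev E.T E.basis := E.hom_eq_of_evalAt fun x => by
      rw [h, Category.assoc, coev_evalAt]
      rfl
    rw [this, Category.assoc, E.zero, Limits.comp_zero]

end EulerSeq

/-! ### Iterated duals along a helix -/

section

variable {C : Type u} [Category.{v} C] [Abelian C]

namespace EulerSeq

variable (k : Type w) [Field k] [Linear k C] {X Y Z : C} (E : EulerSeq X Y Z)
  (hΦ : Function.Bijective E.Phi) (hc : Function.Bijective E.canon)

/-- The isomorphism `Hom(X, Y) ≅ Hom(Y, Z)^*` of bimodules, adjoint to `*Hom(X, Y) ≅ Hom(Y, Z)`. -/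
noncomputable def adjointIso : BimodIso (homBimod k X Y) (homBimod k Y Z).rdual :=
  ((homBimod k X Y).bidual E.basis).trans (E.canonIso k hΦ hc).rdual

/-- The two isomorphisms are adjoint for the evaluation pairing; this transfers the relations from
one side to the other. -/
theorem adjointIso_canon (f : X ⟶ Y) (φ : HomDual X Y) :
    ((E.adjointIso k hΦ hc).m f : (Y ⟶ Z) →ₗ[(End Y)ᵐᵒᵖ] End Y) (E.canon φ) = φ f :=
  (E.canonIso k hΦ hc).rdualMap_apply ((homBimod k X Y).bidualMap f) φ

/-- The same kernel, seen in M ⊗ M^* with M = Hom(Y, Z). It follows from `comp_eq_zero_iff` by the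
adjunction, the scalar d in End X becoming `E.Phi d` in End Z. -/
theorem comp_eq_zero_iff_right (l : List ((Y ⟶ Z) × ((Y ⟶ Z) →ₗ[(End Y)ᵐᵒᵖ] End Y))) :
    (l.map fun p => ((E.adjointIso k hΦ hc).m.symm p.2 : X ⟶ Y) ≫ p.1).sum = 0 ↔
      ∃ d : End Z, ∀ y : Y ⟶ Z, (l.map fun p => op (p.2 y) • p.1).sum = d • y := by
  obtain ⟨l, rfl⟩ : ∃ l' : List (HomDual X Y × (X ⟶ Y)),
      l = l'.map fun p => (E.canon p.1, (E.adjointIso k hΦ hc).m p.2) := by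
    refine ⟨l.map fun p =>
      ((_root_.Equiv.ofBijective _ hc).symm p.1, (E.adjointIso k hΦ hc).m.symm p.2), ?_⟩
    rw [List.map_map]
    refine (List.map_id l).symm.trans (List.map_congr_left fun p _ => Prod.ext ?_ ?_)
    · exact ((_root_.Equiv.ofBijective _ hc).apply_symm_apply p.1).symm
    · exact ((E.adjointIso k hΦ hc).m.apply_symm_apply p.2).symm
  simp only [List.map_map, Function.comp_def]
  have h : ∀ f : X ⟶ Y, (E.adjointIso k hΦ hc).m.symm ((E.adjointIso k hΦ hc).m f) = f :=
    (E.adjointIso k hΦ hc).m.symm_apply_apply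
  simp only [h]
  rw [E.comp_eq_zero_iff, hΦ.surjective.exists]
  refine exists_congr fun d => ?_
  rw [hc.surjective.forall]
  have h' : ∀ φ : HomDual X Y, (l.map fun p => op (((E.adjointIso k hΦ hc).m p.2 :
      (Y ⟶ Z) →ₗ[(End Y)ᵐᵒᵖ] End Y) (E.canon φ)) • E.canon p.1).sum =
      E.canon (l.map fun p => op (φ p.2) • p.1).sum := fun φ => by
    rw [map_list_sum, List.map_map]
    refine congrArg List.sum (List.map_congr_left fun p _ => ?_)
    rw [adjointIso_canon]
    exact (map_smul E.canon _ _).symm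
  simp only [h', ← canon_act, hc.injective.eq_iff]
  have h'' : ∀ (φ : HomDual X Y) (x : X ⟶ Y),
      (l.map fun p => op (φ p.2) • p.1).sum x = φ (l.map fun p => p.1 x • p.2).sum := fun φ x => by
    rw [map_list_sum, List.map_map]
    -- Evaluation at x is written as an additive map so that it passes through the list sum.
    change LinearMap.applyₗ' ℤ x _ = _
    rw [map_list_sum, List.map_map]
    refine congrArg List.sum (List.map_congr_left fun p _ => ?_)
    exact (map_smul φ _ _).symm
  constructor
  · intro H φ
    refine LinearMap.ext fun x => ?_
    rw [h'', H]
    rfl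
  · intro H x
    -- Coordinate functionals suffice to recover an identity in Hom(X, Y) from its image under every
    -- φ.
    refine E.basis.ext_elem fun s => ?_
    exact (h'' (E.basis.coord s) x).symm.trans (LinearMap.congr_fun (H (E.basis.coord s)) x)

end EulerSeq

/-- The bimodules generating the noncommutative symmetric algebra of a sequence. -/
abbrev seqBimod (k : Type w) [Field k] [Linear k C] (L : ℤ → C) (i : ℤ) : Bimod.{w, v} k :=
  homBimod k (L (-(i + 1))) (L (-i))

/-- Euler sequences for all triples of consecutive members of a sequence, with bijective canonical
maps. -/
structure EulerFamily (L : ℤ → C) where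
  E : ∀ i : ℤ, EulerSeq (L (-(i + 1 + 1))) (L (-(i + 1))) (L (-i))
  hΦ : ∀ i, Function.Bijective (E i).Phi
  hc : ∀ i, Function.Bijective (E i).canon

theorem IsHelix.nonempty_eulerFamily {L : ℤ → C} (h : IsHelix L) : Nonempty (EulerFamily L) := by
  -- The integer identities between the indices are not definitional, so free indices are introduced
  -- and substituted.
  have key : ∀ a b c : ℤ, b = a + 1 → c = a + 2 → ∃ E : EulerSeq (L a) (L b) (L c),
      Function.Bijective E.Phi ∧ Function.Bijective E.canon := by
    rintro a b c rfl rfl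
    exact h.euler a
  choose E hE using fun i : ℤ => key (-(i + 1 + 1)) (-(i + 1)) (-i) (by omega) (by omega)
  exact ⟨⟨E, fun i => (hE i).1, fun i => (hE i).2⟩⟩

theorem IsHelix.finiteDim (k : Type w) [Field k] [Linear k C] {L : ℤ → C} (h : IsHelix L) (i : ℤ) :
    (seqBimod k L i).FiniteDim := by
  have key : ∀ a b : ℤ, b = a + 1 → (homBimod k (L a) (L b)).FiniteDim := by
    rintro a b rfl
    exact ⟨⟨h.nontrivial _, h.isUnit _⟩, ⟨h.nontrivial _, h.isUnit _⟩, h.finite_left a,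
      h.finite_right a⟩
  exact key _ _ (by omega)

namespace EulerFamily

variable (k : Type w) [Field k] [Linear k C] {L : ℤ → C} (F : EulerFamily L)

noncomputable def rdualStep (i : ℤ) : BimodIso (seqBimod k L i).rdual (seqBimod k L (i + 1)) :=
  ((F.E i).adjointIso k (F.hΦ i) (F.hc i)).symm

noncomputable def ldualStep (i : ℤ) : BimodIso (seqBimod k L (i + 1)).ldual (seqBimod k L i) :=
  (F.E i).canonIso k (F.hΦ i) (F.hc i)

noncomputable def rdualIterIso : ∀ n : ℕ,
    BimodIso ((seqBimod k L 0).rdualIter n) (seqBimod k L (Int.ofNat n))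
  | 0 => .refl _
  | n + 1 => (rdualIterIso n).rdual.trans (F.rdualStep k (Int.ofNat n))

noncomputable def ldualIterIso : ∀ n : ℕ,
    BimodIso ((seqBimod k L 0).ldualIter n) (seqBimod k L (Int.negSucc n))
  | 0 => (BimodIso.refl (seqBimod k L 0)).ldual.trans (F.ldualStep k (Int.negSucc 0))
  | n + 1 => (ldualIterIso n).ldual.trans (F.ldualStep k (Int.negSucc (n + 1)))

/-- The iterated duals of `Hom(L_{-1}, L_0)` are the bimodules `Hom(L_{-(i+1)}, L_{-i})`. -/
noncomputable def dualIso : ∀ i : ℤ, BimodIso ((seqBimod k L 0).dual i) (seqBimod k L i)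
  | .ofNat n => F.rdualIterIso k n
  | .negSucc n => F.ldualIterIso k n

/-- The ring between two consecutive generators is seen both as right coefficients of one and as
left coefficients of the next. The isomorphisms were built step by step so that both identifications
agree, which each case of the recursion shows by computation. -/
theorem dualIso_right : ∀ (i : ℤ) (b : ((seqBimod k L 0).dual (i + 1)).L)
    (x : ((seqBimod k L 0).dual i).M),
    (F.dualIso k i).m (((seqBimod k L 0).dualModR i).smul (op b) x) =
      (seqBimod k L i).modR.smul (op ((F.dualIso k (i + 1)).l b)) ((F.dualIso k i).m x)
  | .ofNat n, b, x => (F.rdualIterIso k n).right b x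
  | .negSucc 0, b, x => (F.ldualIterIso k 0).right b x
  | .negSucc (n + 1), b, x => (F.ldualIterIso k (n + 1)).right b x

end EulerFamily

end

/-! ### Comparison of the relations and admissibility -/

section

variable {C : Type u} [Category.{v} C] [Abelian C]

namespace EulerFamily

variable (k : Type w) [Field k] [Linear k C] {L : ℤ → C} (F : EulerFamily L)

theorem rel_iff_of_rdual {B : Bimod.{w, v} k} (hB : B.FiniteDim) (i : ℤ)
    (e : BimodIso B (seqBimod k L i)) (l : List (B.M × B.rdual.M)) :
    (l.map fun p => BTensor.tmul B.R (W := B.rdual.M) p.1 p.2).sum ∈ B.unitR ↔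
      compMap (L (-(i + 1 + 1))) (L (-(i + 1))) (L (-i)) (l.map fun p =>
        BTensor.tmul (End (L (-(i + 1)))) (e.m p.1 : L (-(i + 1)) ⟶ L (-i))
          ((e.rdual.trans (F.rdualStep k i)).m p.2 : L (-(i + 1 + 1)) ⟶ L (-(i + 1)))).sum = 0 := by
  rw [e.mem_unitR_iff hB]
  have h1 := (F.E i).comp_eq_zero_iff_right k (F.hΦ i) (F.hc i)
    (l.map fun p => (e.m p.1, e.rdualMap p.2))
  have h2 := compMap_list_sum (l.map fun p => ((e.m p.1 : L (-(i + 1)) ⟶ L (-i)),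
    ((e.rdual.trans (F.rdualStep k i)).m p.2 : L (-(i + 1 + 1)) ⟶ L (-(i + 1)))))
  simp only [List.map_map, Function.comp_def] at h1 h2
  rw [h2]
  exact h1.symm

theorem rel_iff_of_ldual {B : Bimod.{w, v} k} (hB : B.FiniteDim) (i : ℤ)
    (e : BimodIso B (seqBimod k L (i + 1))) (l : List (B.ldual.M × B.M)) :
    (l.map fun p => BTensor.tmul B.L (V := B.ldual.M) p.1 p.2).sum ∈ B.unitL ↔
      compMap (L (-(i + 1 + 1))) (L (-(i + 1))) (L (-i)) (l.map fun p =>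
        BTensor.tmul (End (L (-(i + 1))))
          ((e.ldual.trans (F.ldualStep k i)).m p.1 : L (-(i + 1)) ⟶ L (-i))
          (e.m p.2 : L (-(i + 1 + 1)) ⟶ L (-(i + 1)))).sum = 0 := by
  rw [e.mem_unitL_iff hB]
  have h1 := (F.E i).comp_eq_zero_iff (l.map fun p => (e.ldualMap p.1, e.m p.2))
  have h2 := compMap_list_sum (l.map fun p =>
    (((e.ldual.trans (F.ldualStep k i)).m p.1 : L (-(i + 1)) ⟶ L (-i)),
      (e.m p.2 : L (-(i + 1 + 1)) ⟶ L (-(i + 1)))))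
  simp only [List.map_map, Function.comp_def] at h1 h2
  rw [h2]
  exact h1.symm

/-- The isomorphism between the generators and relations of the two noncommutative symmetric
algebras. -/
noncomputable def dataEquiv (hF : ∀ i, (seqBimod k L i).FiniteDim) :
    QuadData.Equiv (seqBimod k L 0).ncSymData (ncSymSeqData k L) where
  d i := (F.dualIso k i).l
  v i := (F.dualIso k i).m
  left i := (F.dualIso k i).left
  right i := F.dualIso_right k i
  -- For i ≥ 0 the relation is a unit in M^{i*} ⊗ (M^{i*})^*. For i < 0 it is a unit in *N ⊗ N with
  -- N = M^{(i+1)*}, so at i = -1 the bimodule N is M itself and the identity isomorphism is used.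
  rel_iff
    | .ofNat n, l => F.rel_iff_of_rdual k ((F.rdualIterIso k n).finiteDim (hF _)) (Int.ofNat n)
        (F.rdualIterIso k n) l
    | .negSucc 0, l => F.rel_iff_of_ldual k (hF _) (Int.negSucc 0) (BimodIso.refl _) l
    | .negSucc (n + 1), l => F.rel_iff_of_ldual k ((F.ldualIterIso k n).finiteDim (hF _))
        (Int.negSucc (n + 1)) (F.ldualIterIso k n) l

theorem admissible (F : EulerFamily L) (hF : ∀ i, (seqBimod k L i).FiniteDim) :
    (seqBimod k L 0).Admissible := fun i =>
  have h := (F.dualIso k i).finiteDim (hF i)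
  ⟨h.finL, h.finR⟩

end EulerFamily

/-- A shift of a helix is a helix. -/
theorem IsHelix.shift {L : ℤ → C} (h : IsHelix L) (m : ℤ) : IsHelix fun i => L (m + i) where
  nontrivial _ := h.nontrivial _
  isUnit _ := h.isUnit _
  finite_left i := by
    have := h.finite_left (m + i)
    rwa [add_assoc] at this
  finite_right i := by
    have := h.finite_right (m + i)
    rwa [add_assoc] at this
  euler i := by
    have := h.euler (m + i)
    rwa [add_assoc, add_assoc] at this

theorem IsHelix.admissible (k : Type w) [Field k] [Linear k C] {L : ℤ → C} (h : IsHelix L) (i : ℤ) :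
    (homBimod k (L i) (L (i + 1))).Admissible := by
  -- The shift by i + 1 moves Hom(L_i, L_{i+1}) to the position of Hom(L_{-1}, L_0).
  obtain ⟨F⟩ := (h.shift (i + 1)).nonempty_eulerFamily
  have : (homBimod k (L (i + 1 + -(0 + 1))) (L (i + 1 + -0))).Admissible :=
    F.admissible k ((h.shift (i + 1)).finiteDim k)
  have h1 : i + 1 + -(0 + 1) = i := by omega
  have h2 : i + 1 + -0 = i + 1 := by omega
  rwa [h1, h2] at this

end

end NCSym

theorem mainTheorem3 {k : Type w} [Field k] {C : Type u} [Category.{v} C] [Abelian C] [Linear k C]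
    (L : ℤ → C) (hL : NCSym.IsHelix L) :
    ∃ adm : ∀ i : ℤ, (NCSym.homBimod k (L i) (L (i + 1))).Admissible,
      ∃ Φ : ((NCSym.homBimod k (L (-1)) (L 0)).ncSym (adm (-1))).Hom (NCSym.ncSymSeq k L),
        Φ.IsIso ∧
        ∃ κ : (NCSym.ncSymSeq k L).Hom (NCSym.orbitAlgebra k L),
          NCSym.IsInducedByComposition k L κ ∧
          (κ.comp Φ).IsIsoInDegree 0 ∧ (κ.comp Φ).IsIsoInDegree 1 := by
  obtain ⟨F⟩ := hL.nonempty_eulerFamily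
  have hΦ := (F.dataEquiv k (hL.finiteDim k)).isIso_lift
  -- The indices -(0 + 1) and -0 reduce to -1 and 0 by computation, so the source is the algebra of
  -- Hom(L_{-1}, L_0) without any transport.
  refine ⟨hL.admissible k, (F.dataEquiv k (hL.finiteDim k)).rep.lift, hΦ,
    (NCSym.orbitRep k L).lift, NCSym.isInducedByComposition_lift k L, ?_, ?_⟩
  · intro i j hj
    obtain rfl : j = i := by omega
    exact (NCSym.orbitRep_lift_bijective_zero k L j).comp (hΦ j j)
  · rintro i _ rfl
    exact (NCSym.orbitRep_lift_bijective_one k L i).comp (hΦ i (i + 1))
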